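/- Consider the linear model $y_i = x_i^T\beta^* + \epsilon_i$, $i=1,\dots,n$, with i.i.d. pairs $(x_i,\epsilon_i)\in\mathbb{R}^p\times\mathbb{R}$, $\epsilon_i$ independent of $x_i$, where $x_i$ has covariance matrix $\Sigma_x$ and is zero-mean sub-Gaussian with parameter $\sigma_x$ (i.e. $\mathbb{E}\,e^{t u^T x_i}\le e^{\sigma_x^2t^2/2}$ for all unit vectors $u$ and all $t\in\mathbb{R}$), and $\epsilon_i$ is zero-mean sub-Gaussian with parameter $\sigma_\epsilon$. Let $S=\operatorname{supp}(\beta^*)$ with $|S|\le k$, let $X\in\mathbb{R}^{n\times p}$ have rows $x_i^T$, and put $\widehat\Gamma = X^TX/n$, $\mathcal{L}_n(\beta)=\frac12\beta^T\widehat\Gamma\beta-\frac{y^TX}{n}\beta$. For $\rho_\lambda:\mathbb{R}\to\mathbb{R}$ consider the program $$\min_{\|\beta\|_1\le R}\Big\{\mathcal{L}_n(\beta)+\sum_{j=1}^p\rho_\lambda(\beta_j)\Big\}.\qquad(*)$$ A feasible $\tilde\beta$ is a stationary point of $(*)$ if $\langle\nabla\mathcal{L}_n(\tilde\beta)+\nabla\rho_\lambda(\tilde\beta),\beta-\tilde\beta\rangle\ge0$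 for all feasible $\beta$, where $\langle\nabla\rho_\lambda(\tilde\beta),\beta-\tilde\beta\rangle:=\lim_{t\to0^+}\sum_j\rho_\lambda'(\tilde\beta_j+t(\beta_j-\tilde\beta_j))(\beta_j-\tilde\beta_j)$. The oracle estimator is the minimizer of $\mathcal{L}_n$ over all vectors supported in $S$. $|||\cdot|||_\infty$ is the $\ell_\infty$-operator norm (maximal absolute row sum). For $\mu\ge0$, $\rho_\lambda$ is called $\mu$-amenable if it is even with $\rho_\lambda(0)=0$, nondecreasing on $[0,\infty)$, differentiable away from $0$, $t\mapsto\rho_\lambda(t)/t$ is nonincreasing on $(0,\infty)$, $t\mapsto\rho_\lambda(t)+\frac\mu2t^2$ is convex, and $\lim_{t\to0^+}\rho_\lambda'(t)=\lambda$. It is $(\mu,\gamma)$-amenable, $\gamma\in(0,\infty)$, if in addition $\rho'_\lambda(t)=0$ for all $t\ge\gamma\lambda$. Let $\sigma_x,\sigma_\epsilon\ge0$, $0\le\mu<\kappa$ and $\eta<1$. There are constants $c_0,c_\ell,c_u,c_1,c_2,c_3>0$, depending only on $(\sigma_x,\sigma_\epsilon,\kappa,\mu,\eta)$, such that the following holds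 for all $n,p,k,\beta^*$, all distributions as above with $\lambda_{\min}(\Sigma_x)\ge\kappa$ (so that $\mu<\lambda_{\min}(\Sigma_x)$), all $c_\infty\in\mathbb{R}$ and all $\lambda$ and $R>0$ with $$n\ge c_0k\log p,\qquad \|\beta^*\|_1\le\frac R2,\qquad c_\ell\sqrt{\frac{\log p}{n}}\le\lambda\le\frac{c_u}{R}.$$ (a) Let $\rho_\lambda$ be $\mu$-amenable. Then, outside an event of probability at most $c_1\exp(-c_2\min\{k,\log p\})$, whenever $\widehat\Gamma_{SS}$ is invertible with $|||\widehat\Gamma_{SS}^{-1}|||_\infty\le c_\infty$ and $|||\widehat\Gamma_{S^cS}\widehat\Gamma_{SS}^{-1}|||_\infty\le\eta$, the program $(*)$ has a unique stationary point $\widehat\beta$, it is a global minimizer of $(*)$, $\operatorname{supp}(\widehat\beta)\subseteq S$, and $$\|\widehat\beta-\beta^*\|_\infty\le c_3\sqrt{\frac{\log p}{n}}+c_\infty\lambda.$$ (b) Let $\rho_\lambda$ be $(\mu,\gamma)$-amenable for some $\gamma\in(0,\infty)$, and suppose $\min_{j\in S}|\beta^*_j|\ge\lambda(\gamma+c_\infty)+c_3\sqrt{\frac{\log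 p}{n}}$. Then, outside an event of probability at most $c_1\exp(-c_2\min\{k,\log p\})$, whenever $\widehat\Gamma_{SS}$ is invertible with $|||\widehat\Gamma_{SS}^{-1}|||_\infty\le c_\infty$, the oracle estimator is unique, the program $(*)$ has a unique stationary point $\widehat\beta$, it equals the oracle estimator, and $$\|\widehat\beta-\beta^*\|_\infty\le c_3\sqrt{\frac{\log p}{n}}.$$ -/

import Mathlib

open MeasureTheory ProbabilityTheory Filter Topology
open scoped NNReal ENNReal Matrix

noncomputable section

/-- `rho` is a `μ`-amenable univariate regularizer with regularization level `lam`. -/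
structure IsAmenable (μ lam : ℝ) (rho : ℝ → ℝ) : Prop where
  mu_nonneg : 0 ≤ μ
  symm : ∀ t, rho (-t) = rho t
  zero : rho 0 = 0
  mono : MonotoneOn rho (Set.Ici 0)
  ratio_anti : AntitoneOn (fun t => rho t / t) (Set.Ioi 0)
  differentiable : ∀ t, t ≠ 0 → DifferentiableAt ℝ rho t
  weakly_convex : ConvexOn ℝ Set.univ (fun t => rho t + μ / 2 * t ^ 2)
  selection : Tendsto (deriv rho) (𝓝[>] 0) (𝓝 lam)

/-- `rho` is a `(μ, γ)`-amenable regularizer: it is `μ`-amenable and unbiased, i.e. its derivative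
vanishes on `[γ * lam, ∞)`. -/
structure IsUnbiasedAmenable (μ γ lam : ℝ) (rho : ℝ → ℝ) : Prop extends IsAmenable μ lam rho where
  gamma_pos : 0 < γ
  unbiased : ∀ t, γ * lam ≤ t → deriv rho t = 0

/-- The sample covariance matrix `XᵀX / n`. -/
def sampleCov {n p : ℕ} (X : Matrix (Fin n) (Fin p) ℝ) : Matrix (Fin p) (Fin p) ℝ :=
  (n : ℝ)⁻¹ • (Xᵀ * X)

/-- The vector `Xᵀy / n`. -/
def sampleCross {n p : ℕ} (X : Matrix (Fin n) (Fin p) ℝ) (y : Fin n → ℝ) : Fin p → ℝ :=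
  (n : ℝ)⁻¹ • (Xᵀ *ᵥ y)

/-- The least-squares loss `βᵀ(XᵀX/n)β / 2 - (yᵀX/n)β`. -/
def lsLoss {n p : ℕ} (X : Matrix (Fin n) (Fin p) ℝ) (y : Fin n → ℝ) (b : Fin p → ℝ) : ℝ :=
  1 / 2 * (b ⬝ᵥ (sampleCov X *ᵥ b)) - sampleCross X y ⬝ᵥ b

/-- The penalized objective, with the coordinate-separable penalty given by `rho`. -/
def lsObjective {n p : ℕ} (X : Matrix (Fin n) (Fin p) ℝ) (y : Fin n → ℝ) (rho : ℝ → ℝ)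
    (b : Fin p → ℝ) : ℝ :=
  lsLoss X y b + ∑ j, rho (b j)

/-- The feasible region `{b : ‖b‖₁ ≤ R}`. -/
def l1Ball (p : ℕ) (R : ℝ) : Set (Fin p → ℝ) := {b | ∑ j, |b j| ≤ R}

/-- `b` is a stationary point of the program of minimizing `lsObjective X y rho` over `‖b‖₁ ≤ R`:
`⟨∇L(b) + ∇ρ(b), b' - b⟩ ≥ 0` for all feasible `b'`, where
`⟨∇ρ(b), b' - b⟩` stands for the limit of `⟨∇ρ(b + t (b' - b)), b' - b⟩` as `t` decreases to `0`. -/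
def IsStationaryPoint {n p : ℕ} (X : Matrix (Fin n) (Fin p) ℝ) (y : Fin n → ℝ) (rho : ℝ → ℝ)
    (R : ℝ) (b : Fin p → ℝ) : Prop :=
  b ∈ l1Ball p R ∧ ∀ b' ∈ l1Ball p R, ∃ D : ℝ,
    Tendsto (fun t : ℝ => ∑ j, deriv rho (b j + t * (b' j - b j)) * (b' j - b j))
      (𝓝[>] 0) (𝓝 D) ∧
    0 ≤ fderiv ℝ (lsLoss X y) b (b' - b) + D

/-- The support of a vector. -/
def supp {p : ℕ} (b : Fin p → ℝ) : Finset (Fin p) := {j | b j ≠ 0}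

/-- `b` is an oracle estimator for the support set `S`: it minimizes the unpenalized loss among all
vectors supported in `S`. -/
def IsOracle {n p : ℕ} (X : Matrix (Fin n) (Fin p) ℝ) (y : Fin n → ℝ) (S : Finset (Fin p))
    (b : Fin p → ℝ) : Prop :=
  supp b ⊆ S ∧ ∀ b' : Fin p → ℝ, supp b' ⊆ S → lsLoss X y b ≤ lsLoss X y b'

/-- The block `A_SS`. -/
def blockSS {p : ℕ} (A : Matrix (Fin p) (Fin p) ℝ) (S : Finset (Fin p)) :
    Matrix {j // j ∈ S} {j // j ∈ S} ℝ :=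
  A.submatrix Subtype.val Subtype.val

/-- The block `A_{SᶜS}`. -/
def blockScS {p : ℕ} (A : Matrix (Fin p) (Fin p) ℝ) (S : Finset (Fin p)) :
    Matrix {j // j ∉ S} {j // j ∈ S} ℝ :=
  A.submatrix Subtype.val Subtype.val

section

attribute [local instance] Matrix.linftyOpNormedAddCommGroup

/-- The `ℓ∞`-operator norm of a matrix (the largest absolute row sum). -/
def opNormInf {m l : Type*} [Fintype m] [Fintype l] (A : Matrix m l ℝ) : ℝ := ‖A‖

end

/-- `A_SS` is invertible and its inverse has `ℓ∞`-operator norm at most `cinf`. -/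
def InvBound {p : ℕ} (A : Matrix (Fin p) (Fin p) ℝ) (S : Finset (Fin p)) (cinf : ℝ) : Prop :=
  IsUnit (blockSS A S) ∧ opNormInf (blockSS A S)⁻¹ ≤ cinf

/-- The smallest eigenvalue of a symmetric real matrix. -/
def lambdaMin {p : ℕ} (A : Matrix (Fin p) (Fin p) ℝ) : ℝ := sInf (spectrum ℝ A)

/-- The pairs `(x i, ε i)` are i.i.d., covariates and noise are independent, the covariates have
covariance matrix `Sig`, every projection of `x i` on a unit vector is sub-Gaussian with parameter
`σx` (in particular centered), and `ε i` is sub-Gaussian with parameter `σε`. -/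
structure IsSubGaussianDesign {Ω : Type*} [MeasurableSpace Ω] (P : Measure Ω) {n p : ℕ}
    (x : Fin n → Ω → Fin p → ℝ) (ε : Fin n → Ω → ℝ) (Sig : Matrix (Fin p) (Fin p) ℝ)
    (σx σε : ℝ≥0) : Prop where
  measurable_x : ∀ i, Measurable (x i)
  measurable_noise : ∀ i, Measurable (ε i)
  indep : iIndepFun (fun i ω => (x i ω, ε i ω)) P
  ident : ∀ i i', IdentDistrib (fun ω => (x i ω, ε i ω)) (fun ω => (x i' ω, ε i' ω)) P P
  indep_noise : ∀ i, IndepFun (x i) (ε i) P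
  cov_x : ∀ i j l, covariance (fun ω => x i ω j) (fun ω => x i ω l) P = Sig j l
  subGaussian_x : ∀ i (u : Fin p → ℝ), u ⬝ᵥ u = 1 →
    HasSubgaussianMGF (fun ω => u ⬝ᵥ x i ω) (σx ^ 2) P
  subGaussian_noise : ∀ i, HasSubgaussianMGF (ε i) (σε ^ 2) P

/-- The random design matrix, with rows `x i`. -/
def designMatrix {Ω : Type*} {n p : ℕ} (x : Fin n → Ω → Fin p → ℝ) (ω : Ω) :
    Matrix (Fin n) (Fin p) ℝ :=
  Matrix.of fun i j => x i ω j

/-- The response of the linear model `y = X β* + ε`. -/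
def response {Ω : Type*} {n p : ℕ} (x : Fin n → Ω → Fin p → ℝ) (ε : Fin n → Ω → ℝ)
    (βs : Fin p → ℝ) (ω : Ω) : Fin n → ℝ :=
  designMatrix x ω *ᵥ βs + fun i => ε i ω

end

/-! The proof is a primal-dual witness argument. Write `Γ` for the sample covariance and `L = log p
/ n`. On an event of probability at least `1 - 8/p` the design satisfies restricted strong
convexity, `vᵀΓv ≥ a‖v‖₂² - τL‖v‖₁²` with `a > μ`, and the relevant projections of the noise are of
order `√L`. Everything else is deterministic.

Uniqueness (`stationary_unique_of_margin`): suppose a feasible `βh` satisfies the first-order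
conditions with slack `δλ` off `S`. Adding its variational inequality to that of another stationary
point at distance `v` gives `vᵀΓv + δλ‖v_{Sᶜ}‖₁ ≤ μ‖v‖₂²`. Since `‖v‖₁ ≤ 2R`, the tolerance
`τL‖v‖₁²` is absorbed, on `S` by `|S| ≤ k` and `n ≳ k log p`, off `S` by `4RτL ≤ δλ`; this is where
both bounds on `λ` enter. Hence `v = 0`. Convexity up to `μ` also gives global minimality.

Existence, part (a): minimize over vectors supported in `S` in a ball of radius `2R`. The scalar
inequality `shrinkage`, summed over coordinates, forces `‖b‖₁ ≤ 2‖β*‖₁ ≤ R`, so the side constraint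
is inactive and the gradient on `S` is at most `λ` in absolute value. Incoherence transfers this to
`Sᶜ` with the required slack. In part (b) the candidate is the least-squares solution on `S`: its
coordinates exceed `γλ`, the penalty is flat there, the gradient vanishes on `S`, and no incoherence
is needed.

Noise: the design is independent of the noise, so by Fubini a functional `a(X) ⬝ᵥ Xᵀε/n` is
sub-Gaussian with variance proxy of order `aᵀΓa / n`. For the rows of `Γ_SS⁻¹` this quadratic form
is at most `1/α`, and for the residual directions off `S` at most `Γ_jj`; so `c3` does not involve
`cinf`.

Restricted strong convexity is proved by Maurey's empirical method: if `Γ - a·1` is nonnegative on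
all sums of `m` signed basis vectors, averaging gives the bound with tolerance of order `1/m`. There
are `(2p)^m` such sums, and a union bound with a lower tail for sums of squares allows `m` of order
`n / log p`. -/

/-! ### Amenable regularizers -/

/-- The directional derivative of an amenable regularizer at `b` in the direction `v`. -/
noncomputable def dirDeriv (lam : ℝ) (rho : ℝ → ℝ) (b v : ℝ) : ℝ :=
  if b = 0 then lam * |v| else deriv rho b * v

namespace IsAmenable

variable {μ lam : ℝ} {rho : ℝ → ℝ}

lemma deriv_neg (h : IsAmenable μ lam rho) (t : ℝ) : deriv rho (-t) = -deriv rho t := by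
  have : deriv (fun x => rho (-x)) t = -deriv rho (-t) := deriv_comp_neg rho t
  rw [funext h.symm] at this
  linarith

lemma continuous (h : IsAmenable μ lam rho) : Continuous rho := by
  have h1 : ContinuousOn (fun t => rho t + μ / 2 * t ^ 2) Set.univ :=
    h.weakly_convex.continuousOn isOpen_univ
  rw [continuousOn_univ] at h1
  have h2 : rho = fun t => (rho t + μ / 2 * t ^ 2) - μ / 2 * t ^ 2 := by ext; ring
  rw [h2]
  fun_prop

lemma hasDerivAt (h : IsAmenable μ lam rho) {t : ℝ} (ht : t ≠ 0) :
    HasDerivAt rho (deriv rho t) t := (h.differentiable t ht).hasDerivAt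

lemma hasDerivWithinAt_zero (h : IsAmenable μ lam rho) :
    HasDerivWithinAt rho lam (Set.Ici 0) 0 := by
  refine hasDerivWithinAt_Ici_of_tendsto_deriv (s := Set.Ioi 0) ?_
    h.continuous.continuousWithinAt self_mem_nhdsWithin h.selection
  exact fun t ht => (h.differentiable t (ne_of_gt ht)).differentiableWithinAt

/-- Adding `μ t² / 2` makes the regularizer convex, so the bounds on `deriv rho` are obtained from
this corrected function. -/
lemma hasDerivAt_convex (h : IsAmenable μ lam rho) {t : ℝ} (ht : t ≠ 0) :
    HasDerivAt (fun t => rho t + μ / 2 * t ^ 2) (deriv rho t + μ * t) t := by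
  have := (h.hasDerivAt ht).add (((hasDerivAt_id t).pow 2).const_mul (μ / 2))
  refine this.congr_deriv ?_
  simp only [id_eq]; push_cast; ring

/-- The subgradient inequality at a nonzero point. -/
lemma subgradient (h : IsAmenable μ lam rho) {t : ℝ} (ht : t ≠ 0) (s : ℝ) :
    rho t + μ / 2 * t ^ 2 + (deriv rho t + μ * t) * (s - t) ≤ rho s + μ / 2 * s ^ 2 := by
  have hd := h.hasDerivAt_convex ht
  rcases lt_trichotomy s t with hst | rfl | hst
  · have := h.weakly_convex.slope_le_of_hasDerivAt (Set.mem_univ s) (Set.mem_univ t) hst hd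
    rw [slope_def_field, div_le_iff₀ (by linarith)] at this
    linarith
  · simp
  · have := h.weakly_convex.le_slope_of_hasDerivAt (Set.mem_univ t) (Set.mem_univ s) hst hd
    rw [slope_def_field, le_div_iff₀ (by linarith)] at this
    linarith

/-- The subgradient inequality at the kink, obtained by letting the base point tend to `0` from the
right. -/
lemma lam_mul_abs_le (h : IsAmenable μ lam rho) (s : ℝ) : lam * |s| ≤ rho s + μ / 2 * s ^ 2 := by
  wlog hs : 0 ≤ s generalizing s
  · have := this (-s) (by linarith)
    rwa [abs_neg, h.symm, neg_sq] at this
  rw [abs_of_nonneg hs]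
  have h1 : Tendsto (fun t => rho t + μ / 2 * t ^ 2 + (deriv rho t + μ * t) * (s - t)) (𝓝[>] 0)
      (𝓝 (rho 0 + μ / 2 * 0 ^ 2 + (lam + μ * 0) * (s - 0))) := by
    have hid : Tendsto (fun t : ℝ => t) (𝓝[>] 0) (𝓝 0) := tendsto_nhdsWithin_of_tendsto_nhds tendsto_id
    have hr : Tendsto rho (𝓝[>] 0) (𝓝 (rho 0)) :=
      tendsto_nhdsWithin_of_tendsto_nhds h.continuous.continuousAt
    exact (hr.add ((hid.pow 2).const_mul _)).add
      ((h.selection.add (hid.const_mul _)).mul (tendsto_const_nhds.sub hid))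
  have h2 := le_of_tendsto h1 (b := rho s + μ / 2 * s ^ 2) (by
    filter_upwards [self_mem_nhdsWithin] with t ht
    exact h.subgradient (ne_of_gt ht) s)
  rw [h.zero] at h2
  linarith

/-- The subgradient inequality for directional derivatives. -/
lemma dirDeriv_le (h : IsAmenable μ lam rho) (b v : ℝ) :
    rho b + μ / 2 * b ^ 2 + dirDeriv lam rho b v + μ * b * v ≤
      rho (b + v) + μ / 2 * (b + v) ^ 2 := by
  unfold dirDeriv
  split_ifs with hb
  · subst hb
    have := h.lam_mul_abs_le v
    simpa [h.zero] using this
  · have := h.subgradient hb (b + v)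
    have e : b + v - b = v := by ring
    rw [e] at this
    linarith

lemma deriv_add_mono (h : IsAmenable μ lam rho) {s t : ℝ} (hs : s ≠ 0) (ht : t ≠ 0) (hst : s ≤ t) :
    deriv rho s + μ * s ≤ deriv rho t + μ * t := by
  rcases hst.eq_or_lt with rfl | hlt
  · rfl
  have h1 := h.subgradient hs t
  have h2 := h.subgradient ht s
  have h3 : (deriv rho s + μ * s) * (t - s) ≤ (deriv rho t + μ * t) * (t - s) := by nlinarith
  exact le_of_mul_le_mul_right h3 (by linarith)

lemma deriv_nonneg (h : IsAmenable μ lam rho) {t : ℝ} (ht : 0 < t) : 0 ≤ deriv rho t := by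
  have h1 : derivWithin rho (Set.Ici 0) t = deriv rho t :=
    derivWithin_of_mem_nhds (Ici_mem_nhds ht)
  rw [← h1]
  exact h.mono.derivWithin_nonneg

lemma le_deriv (h : IsAmenable μ lam rho) {t : ℝ} (ht : 0 < t) : lam - μ * t ≤ deriv rho t := by
  have hid : Tendsto (fun t : ℝ => t) (𝓝[>] 0) (𝓝 0) := tendsto_nhdsWithin_of_tendsto_nhds tendsto_id
  have h1 : Tendsto (fun s => deriv rho s + μ * s) (𝓝[>] 0) (𝓝 (lam + μ * 0)) :=
    h.selection.add (hid.const_mul _)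
  have h2 := le_of_tendsto h1 (b := deriv rho t + μ * t) (by
    filter_upwards [Ioo_mem_nhdsGT ht] with s hs
    exact h.deriv_add_mono (ne_of_gt hs.1) (ne_of_gt ht) hs.2.le)
  linarith

lemma le_lam_mul (h : IsAmenable μ lam rho) {t : ℝ} (ht : 0 < t) : rho t ≤ lam * t := by
  have h1 : Tendsto (fun s => rho s / s) (𝓝[>] 0) (𝓝 lam) := by
    have := hasDerivWithinAt_iff_tendsto_slope' (s := Set.Ioi 0) (by simp) |>.1
      (h.hasDerivWithinAt_zero.mono Set.Ioi_subset_Ici_self)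
    refine this.congr fun s => ?_
    rw [slope_def_field, h.zero, sub_zero, sub_zero]
  have h2 := ge_of_tendsto h1 (b := rho t / t) (by
    filter_upwards [Ioo_mem_nhdsGT ht] with s hs
    exact h.ratio_anti (Set.mem_Ioi.2 hs.1) (Set.mem_Ioi.2 ht) hs.2.le)
  rwa [div_le_iff₀ ht] at h2

/-- Since `rho t / t` is nonincreasing, `t * deriv rho t ≤ rho t`; the same monotonicity and the
slope at `0` give `rho t ≤ lam * t`. -/
lemma deriv_le (h : IsAmenable μ lam rho) {t : ℝ} (ht : 0 < t) : deriv rho t ≤ lam := by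
  have h0 : HasDerivAt (fun s => rho s / s) ((deriv rho t * t - rho t * 1) / t ^ 2) t :=
    (h.hasDerivAt ht.ne').div (hasDerivAt_id t) ht.ne'
  have h1 : derivWithin (fun s => rho s / s) (Set.Ioi 0) t ≤ 0 := h.ratio_anti.derivWithin_nonpos
  rw [derivWithin_of_mem_nhds (Ioi_mem_nhds ht), h0.deriv, div_nonpos_iff] at h1
  have h2 : deriv rho t * t ≤ rho t := by
    rcases h1 with h1 | h1
    · have := h1.2; nlinarith [pow_pos ht 2]
    · linarith [h1.1]
  have := h.le_lam_mul ht
  exact le_of_mul_le_mul_right (h2.trans this) ht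

lemma abs_deriv_le (h : IsAmenable μ lam rho) {t : ℝ} (ht : t ≠ 0) : |deriv rho t| ≤ lam := by
  rcases lt_or_gt_of_ne ht with ht | ht
  · have h1 := h.deriv_le (neg_pos.2 ht)
    have h2 := h.deriv_nonneg (neg_pos.2 ht)
    rw [h.deriv_neg] at h1 h2
    rw [abs_le]; constructor <;> linarith
  · rw [abs_of_nonneg (h.deriv_nonneg ht)]; exact h.deriv_le ht

/-- A convex function differentiable near a point has a continuous derivative there: nearby
derivatives are squeezed by secant slopes, which depend continuously on their endpoints.
Stationarity involves limits of `deriv rho` at moving points, hence the need. -/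
lemma continuousAt_deriv (h : IsAmenable μ lam rho) {b : ℝ} (hb : b ≠ 0) :
    ContinuousAt (deriv rho) b := by
  wlog hb0 : 0 < b generalizing b
  · have h1 := this (neg_ne_zero.2 hb) (by
      have := lt_of_le_of_ne (not_lt.1 hb0) hb; linarith)
    have h2 : deriv rho = fun t => -deriv rho (-t) := by ext t; rw [h.deriv_neg]; ring
    rw [h2]
    exact (ContinuousAt.comp (f := fun t : ℝ => -t) h1 continuousAt_neg).neg
  have hne : ∀ᶠ t in 𝓝 b, 0 < t := lt_mem_nhds hb0
  set q' : ℝ → ℝ := fun t => deriv rho t + μ * t with hq'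
  suffices hc : ContinuousAt q' b by
    have : deriv rho = fun t => q' t - μ * t := by ext; simp [hq']
    rw [this]; fun_prop
  rw [ContinuousAt, tendsto_order]
  have hd := h.hasDerivAt_convex hb
  have hslope := (hasDerivAt_iff_tendsto_slope.1 hd)
  have hcont : Continuous (fun t => rho t + μ / 2 * t ^ 2) := by
    have := h.continuous; fun_prop
  constructor
  · intro a ha
    have hsl : ∀ᶠ s in 𝓝[<] b, a < slope (fun t => rho t + μ / 2 * t ^ 2) b s :=
      (hslope.mono_left (nhdsWithin_mono _ (fun x hx => ne_of_lt hx))).eventually (lt_mem_nhds ha)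
    obtain ⟨s, hs, hsb⟩ := (hsl.and (Ioo_mem_nhdsLT hb0)).exists
    rw [slope_comm, slope_def_field, lt_div_iff₀ (by linarith [hsb.2])] at hs
    have hev : ∀ᶠ t in 𝓝 b, a * (t - s) < (rho t + μ / 2 * t ^ 2) - (rho s + μ / 2 * s ^ 2) := by
      have hl : ContinuousAt (fun t => a * (t - s)) b := by fun_prop
      have hr : ContinuousAt (fun t => (rho t + μ / 2 * t ^ 2) - (rho s + μ / 2 * s ^ 2)) b :=
        (hcont.sub continuous_const).continuousAt
      exact hl.eventually_lt hr hs
    filter_upwards [hev, hne, lt_mem_nhds hsb.2] with t h1 h2 h3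
    have := h.subgradient h2.ne' s
    have h5 : a * (t - s) < q' t * (t - s) := by simp only [hq']; linarith
    exact lt_of_mul_lt_mul_right h5 (by linarith)
  · intro a ha
    have hsl : ∀ᶠ s in 𝓝[>] b, slope (fun t => rho t + μ / 2 * t ^ 2) b s < a :=
      (hslope.mono_left (nhdsWithin_mono _ (fun x hx => ne_of_gt hx))).eventually (gt_mem_nhds ha)
    obtain ⟨s, hs, hsb⟩ := (hsl.and self_mem_nhdsWithin).exists
    have hsb : b < s := hsb
    rw [slope_def_field, div_lt_iff₀ (by linarith)] at hs
    have hev : ∀ᶠ t in 𝓝 b, (rho s + μ / 2 * s ^ 2) - (rho t + μ / 2 * t ^ 2) < a * (s - t) := by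
      have hl : ContinuousAt (fun t => a * (s - t)) b := by fun_prop
      have hr : ContinuousAt (fun t => (rho s + μ / 2 * s ^ 2) - (rho t + μ / 2 * t ^ 2)) b :=
        (continuous_const.sub hcont).continuousAt
      exact hr.eventually_lt hl hs
    filter_upwards [hev, hne, gt_mem_nhds hsb] with t h1 h2 h3
    have := h.subgradient h2.ne' s
    have h5 : q' t * (s - t) < a * (s - t) := by simp only [hq']; linarith
    exact lt_of_mul_lt_mul_right h5 (by linarith)

lemma tendsto_dirDeriv (h : IsAmenable μ lam rho) (b v : ℝ) :
    Tendsto (fun t : ℝ => deriv rho (b + t * v) * v) (𝓝[>] 0) (𝓝 (dirDeriv lam rho b v)) := by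
  have key : ∀ v : ℝ, 0 < v → Tendsto (fun t : ℝ => deriv rho (t * v)) (𝓝[>] 0) (𝓝 lam) := by
    intro v hv
    refine h.selection.comp (tendsto_nhdsWithin_iff.2 ⟨?_, ?_⟩)
    · have : Tendsto (fun t : ℝ => t * v) (𝓝 0) (𝓝 (0 * v)) := (continuous_mul_const v).tendsto 0
      rw [zero_mul] at this
      exact tendsto_nhdsWithin_of_tendsto_nhds this
    · filter_upwards [self_mem_nhdsWithin] with t ht
      exact mul_pos ht hv
  unfold dirDeriv
  split_ifs with hb
  · subst hb
    simp only [zero_add]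
    rcases lt_trichotomy v 0 with hv | rfl | hv
    · rw [abs_of_neg hv]
      have := ((key (-v) (by linarith)).mul_const (-v))
      refine this.congr fun t => ?_
      have e : t * -v = -(t * v) := by ring
      rw [e, h.deriv_neg]; ring
    · simp
    · rw [abs_of_pos hv]
      exact (key v hv).mul_const v
  · have h1 : Tendsto (fun t : ℝ => b + t * v) (𝓝[>] 0) (𝓝 b) := by
      have : ContinuousAt (fun t : ℝ => b + t * v) 0 := by fun_prop
      have h2 := this.tendsto
      simp only [zero_mul, add_zero] at h2
      exact tendsto_nhdsWithin_of_tendsto_nhds h2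
    exact ((h.continuousAt_deriv hb).tendsto.comp h1).mul_const v

/-- The one-sided derivative of the regularizer along a line. -/
lemma hasDerivWithinAt_line (h : IsAmenable μ lam rho) (b v : ℝ) :
    HasDerivWithinAt (fun t : ℝ => rho (b + t * v)) (dirDeriv lam rho b v) (Set.Ici 0) 0 := by
  unfold dirDeriv
  split_ifs with hb
  · subst hb
    have e : (fun t : ℝ => rho (0 + t * v)) = fun t => rho (t * |v|) := by
      ext t
      rcases abs_choice v with hv | hv
      · rw [hv, zero_add]
      · rw [hv, zero_add, mul_neg, h.symm]
    rw [e]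
    have h1 : HasDerivWithinAt (fun t : ℝ => t * |v|) |v| (Set.Ici 0) 0 := by
      simpa using ((hasDerivAt_id (0:ℝ)).mul_const |v|).hasDerivWithinAt
    have h2 : HasDerivWithinAt rho lam (Set.Ici 0) (0 * |v|) := by
      rw [zero_mul]; exact h.hasDerivWithinAt_zero
    exact h2.comp (0 : ℝ) h1 fun t ht => mul_nonneg ht (abs_nonneg v)
  · have h1 : HasDerivAt (fun t : ℝ => b + t * v) v 0 := by
      simpa using ((hasDerivAt_id (0:ℝ)).mul_const v).const_add b
    have h2 : HasDerivAt rho (deriv rho b) (b + 0 * v) := by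
      simpa using h.hasDerivAt hb
    exact (h2.comp (0 : ℝ) h1).hasDerivWithinAt

/-- Monotonicity of the subgradient up to `μ`: in the sum of the two subgradient inequalities the
values of `rho` cancel. -/
lemma dirDeriv_add_nonpos (h : IsAmenable μ lam rho) (b v : ℝ) :
    dirDeriv lam rho b v + dirDeriv lam rho (b + v) (-v) ≤ μ * v ^ 2 := by
  have h1 := h.dirDeriv_le b v
  have h2 := h.dirDeriv_le (b + v) (-v)
  have e : b + v + -v = b := by ring
  rw [e] at h2
  nlinarith

end IsAmenable

/-! ### The least-squares loss -/

section Loss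

variable {n p : ℕ} (X : Matrix (Fin n) (Fin p) ℝ) (y : Fin n → ℝ)

/-- The gradient of the least-squares loss. -/
noncomputable def lsGrad (b : Fin p → ℝ) : Fin p → ℝ := sampleCov X *ᵥ b - sampleCross X y

lemma sampleCov_transpose : (sampleCov X)ᵀ = sampleCov X := by
  simp [sampleCov, Matrix.transpose_smul, Matrix.transpose_mul]

lemma dotProduct_sampleCov (u v : Fin p → ℝ) :
    u ⬝ᵥ (sampleCov X *ᵥ v) = (n : ℝ)⁻¹ * ((X *ᵥ u) ⬝ᵥ (X *ᵥ v)) := by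
  rw [sampleCov, Matrix.smul_mulVec, dotProduct_smul, smul_eq_mul, ← Matrix.mulVec_mulVec,
    Matrix.dotProduct_mulVec, Matrix.vecMul_transpose]

lemma dotProduct_sampleCov_comm (u v : Fin p → ℝ) :
    u ⬝ᵥ (sampleCov X *ᵥ v) = v ⬝ᵥ (sampleCov X *ᵥ u) := by
  rw [dotProduct_sampleCov, dotProduct_sampleCov, dotProduct_comm]

lemma quad_sampleCov_nonneg (v : Fin p → ℝ) : 0 ≤ v ⬝ᵥ (sampleCov X *ᵥ v) := by
  rw [dotProduct_sampleCov]
  exact mul_nonneg (by positivity) (Finset.sum_nonneg fun i _ => mul_self_nonneg _)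

lemma lsLoss_add (b v : Fin p → ℝ) :
    lsLoss X y (b + v) = lsLoss X y b + lsGrad X y b ⬝ᵥ v +
      1 / 2 * (v ⬝ᵥ (sampleCov X *ᵥ v)) := by
  have h := dotProduct_sampleCov_comm X b v
  simp only [lsLoss, lsGrad, Matrix.mulVec_add, add_dotProduct, dotProduct_add, sub_dotProduct]
  rw [h, dotProduct_comm (sampleCov X *ᵥ b) v]
  ring

lemma continuous_lsLoss : Continuous (lsLoss X y) := by
  unfold lsLoss
  simp only [dotProduct, Matrix.mulVec]
  fun_prop

lemma differentiable_lsLoss : Differentiable ℝ (lsLoss X y) := by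
  unfold lsLoss
  simp only [dotProduct, Matrix.mulVec]
  fun_prop

lemma hasDerivAt_lsLoss_line (b v : Fin p → ℝ) :
    HasDerivAt (fun t : ℝ => lsLoss X y (b + t • v)) (lsGrad X y b ⬝ᵥ v) 0 := by
  have e : (fun t : ℝ => lsLoss X y (b + t • v)) = fun t : ℝ =>
      lsLoss X y b + t * (lsGrad X y b ⬝ᵥ v) + t ^ 2 * (1 / 2 * (v ⬝ᵥ (sampleCov X *ᵥ v))) := by
    ext t
    rw [lsLoss_add]
    simp only [Matrix.mulVec_smul, dotProduct_smul, smul_dotProduct, smul_eq_mul]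
    ring
  rw [e]
  have h1 := ((hasDerivAt_id (0:ℝ)).mul_const (lsGrad X y b ⬝ᵥ v)).const_add (lsLoss X y b)
  have h2 := ((hasDerivAt_id (0:ℝ)).pow 2).mul_const (1 / 2 * (v ⬝ᵥ (sampleCov X *ᵥ v)))
  exact (h1.add h2).congr_deriv (by simp)

lemma fderiv_lsLoss (b v : Fin p → ℝ) : fderiv ℝ (lsLoss X y) b v = lsGrad X y b ⬝ᵥ v := by
  have h1 : HasLineDerivAt ℝ (lsLoss X y) (fderiv ℝ (lsLoss X y) b v) b v :=
    ((differentiable_lsLoss X y) b).hasFDerivAt.hasLineDerivAt v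
  have h2 : HasLineDerivAt ℝ (lsLoss X y) (lsGrad X y b ⬝ᵥ v) b v := hasDerivAt_lsLoss_line X y b v
  exact h1.unique h2

lemma lsGrad_add (b v : Fin p → ℝ) : lsGrad X y (b + v) = lsGrad X y b + sampleCov X *ᵥ v := by
  simp only [lsGrad, Matrix.mulVec_add]; abel

/-- For amenable `rho` the limit in the definition always exists and is unique, so it can be
replaced by its explicit value. -/
lemma isStationaryPoint_iff {μ lam : ℝ} {rho : ℝ → ℝ} (h : IsAmenable μ lam rho) (R : ℝ)
    (b : Fin p → ℝ) :
    IsStationaryPoint X y rho R b ↔ b ∈ l1Ball p R ∧ ∀ b' ∈ l1Ball p R,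
      0 ≤ lsGrad X y b ⬝ᵥ (b' - b) + ∑ j, dirDeriv lam rho (b j) (b' j - b j) := by
  have ht : ∀ b' : Fin p → ℝ,
      Tendsto (fun t : ℝ => ∑ j, deriv rho (b j + t * (b' j - b j)) * (b' j - b j))
      (𝓝[>] 0) (𝓝 (∑ j, dirDeriv lam rho (b j) (b' j - b j))) := fun b' =>
    tendsto_finsetSum _ fun j _ => h.tendsto_dirDeriv (b j) (b' j - b j)
  unfold IsStationaryPoint
  refine and_congr_right fun _ => forall₂_congr fun b' _ => ?_
  rw [fderiv_lsLoss]
  constructor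
  · rintro ⟨D, hD, h0⟩
    rwa [tendsto_nhds_unique hD (ht b')] at h0
  · exact fun h0 => ⟨_, ht b', h0⟩

/-- A feasible point whose first-order conditions hold with a margin outside `S` is the unique
stationary point and a global minimizer, provided that the loss is sufficiently curved. -/
lemma stationary_unique_of_margin {μ lam : ℝ} {rho : ℝ → ℝ} (h : IsAmenable μ lam rho)
    {R δ c : ℝ} {S : Finset (Fin p)} (hc : 0 < c) (hδ : 0 ≤ δ * lam) {bh : Fin p → ℝ}
    (hR : bh ∈ l1Ball p R)
    (hcert : ∀ v : Fin p → ℝ, δ * lam * ∑ j ∈ Sᶜ, |v j| ≤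
      lsGrad X y bh ⬝ᵥ v + ∑ j, dirDeriv lam rho (bh j) (v j))
    (hcurv : ∀ v : Fin p → ℝ, ∑ j, |v j| ≤ 2 * R →
      c * (v ⬝ᵥ v) ≤ v ⬝ᵥ (sampleCov X *ᵥ v) - μ * (v ⬝ᵥ v) + δ * lam * ∑ j ∈ Sᶜ, |v j|) :
    (∀ b, IsStationaryPoint X y rho R b ↔ b = bh) ∧
      IsMinOn (lsObjective X y rho) (l1Ball p R) bh := by
  have hdiff : ∀ b ∈ l1Ball p R, ∑ j, |(b - bh) j| ≤ 2 * R := by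
    intro b hb
    have h1 : ∑ j, |(b - bh) j| ≤ ∑ j, (|b j| + |bh j|) :=
      Finset.sum_le_sum fun j _ => by
        rw [Pi.sub_apply]; exact abs_sub _ _
    rw [Finset.sum_add_distrib] at h1
    have h2 : ∑ j, |b j| ≤ R := hb
    have h3 : ∑ j, |bh j| ≤ R := hR
    linarith
  constructor
  · intro b
    rw [isStationaryPoint_iff X y h]
    constructor
    · rintro ⟨hb, hst⟩
      set v := b - bh with hv
      have hbv : b = bh + v := by rw [hv]; abel
      have h1 := hst bh hR
      have h2 := hcert v
      have h3 := hcurv v (hdiff b hb)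
      have e1 : bh - b = -v := by rw [hv]; abel
      have e2 : lsGrad X y b ⬝ᵥ (bh - b) =
          -(lsGrad X y bh ⬝ᵥ v) - v ⬝ᵥ (sampleCov X *ᵥ v) := by
        rw [e1, hbv, lsGrad_add, dotProduct_neg, add_dotProduct, dotProduct_comm v]; ring
      have h4 : ∑ j, dirDeriv lam rho (bh j) (v j) + ∑ j, dirDeriv lam rho (b j) (bh j - b j)
          ≤ μ * (v ⬝ᵥ v) := by
        rw [← Finset.sum_add_distrib, dotProduct, Finset.mul_sum]
        refine Finset.sum_le_sum fun j _ => ?_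
        have := h.dirDeriv_add_nonpos (bh j) (v j)
        have e3 : b j = bh j + v j := by rw [hbv]; rfl
        have e4 : bh j - b j = - v j := by rw [e3]; ring
        rw [e4, e3]
        linarith [this, sq (v j)]
      have h0 : 0 ≤ v ⬝ᵥ v := Finset.sum_nonneg fun i _ => mul_self_nonneg _
      -- Stationarity of `b` tested at `bh`, the certificate at `bh` and weak monotonicity of the
      -- penalty add up to `vᵀΓv - μ‖v‖² + δλ‖v_{Sᶜ}‖₁ ≤ 0`, against `hcurv`.
      have h5 : c * (v ⬝ᵥ v) ≤ 0 := by linarith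
      have h6 : v ⬝ᵥ v = 0 := le_antisymm (by nlinarith) h0
      rw [dotProduct_self_eq_zero] at h6
      rw [hbv, h6, add_zero]
    · rintro rfl
      refine ⟨hR, fun b' _ => ?_⟩
      refine le_trans (mul_nonneg hδ (Finset.sum_nonneg fun j _ => abs_nonneg _)) (hcert (b' - b))
  · intro b hb
    set v := b - bh with hv
    have hbv : b = bh + v := by rw [hv]; abel
    have h2 := hcert v
    have h3 := hcurv v (hdiff b hb)
    have h0 : 0 ≤ v ⬝ᵥ v := Finset.sum_nonneg fun i _ => mul_self_nonneg _
    have h4 : ∑ j, (rho (bh j) + dirDeriv lam rho (bh j) (v j) - μ / 2 * (v j * v j)) ≤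
        ∑ j, rho (b j) := by
      refine Finset.sum_le_sum fun j _ => ?_
      have := h.dirDeriv_le (bh j) (v j)
      have e3 : b j = bh j + v j := by rw [hbv]; rfl
      rw [e3]
      nlinarith
    rw [Finset.sum_sub_distrib, Finset.sum_add_distrib, ← Finset.mul_sum] at h4
    change lsObjective X y rho bh ≤ lsObjective X y rho b
    unfold lsObjective
    rw [hbv, lsLoss_add, ← hbv]
    have e : v ⬝ᵥ v = ∑ j, v j * v j := rfl
    rw [← e] at h4
    -- The certificate supplies the whole slack, while the quadratic terms carry a factor `1/2` and
    -- use up only half of it.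
    have hS : 0 ≤ δ * lam * ∑ j ∈ Sᶜ, |v j| :=
      mul_nonneg hδ (Finset.sum_nonneg fun j _ => abs_nonneg _)
    have := mul_nonneg hc.le h0
    linarith

/-- First-order conditions, coordinate by coordinate, with a margin outside `S`. -/
lemma margin_of_coord {lam δ : ℝ} {rho : ℝ → ℝ} {S : Finset (Fin p)} {b g : Fin p → ℝ}
    (hS : ∀ j, b j ≠ 0 → g j = -deriv rho (b j))
    (hS0 : ∀ j, b j = 0 → |g j| ≤ lam)
    (hb : ∀ j ∉ S, b j = 0) (hSc : ∀ j ∉ S, |g j| ≤ (1 - δ) * lam) (v : Fin p → ℝ) :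
    δ * lam * ∑ j ∈ Sᶜ, |v j| ≤ g ⬝ᵥ v + ∑ j, dirDeriv lam rho (b j) (v j) := by
  have e : δ * lam * ∑ j ∈ Sᶜ, |v j| = ∑ j, if j ∈ Sᶜ then δ * lam * |v j| else 0 := by
    rw [Finset.mul_sum, Finset.sum_ite_mem, Finset.univ_inter]
  rw [e, dotProduct, ← Finset.sum_add_distrib]
  refine Finset.sum_le_sum fun j _ => ?_
  have hgv : -(|g j| * |v j|) ≤ g j * v j := by
    rw [← abs_mul]; exact neg_abs_le _
  unfold dirDeriv
  by_cases hj : j ∈ S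
  · rw [if_neg (by simpa using hj)]
    split_ifs with h0
    · have := mul_le_mul_of_nonneg_right (hS0 j h0) (abs_nonneg (v j))
      linarith
    · rw [hS j h0]; linarith
  · rw [if_pos (by simpa using hj), if_pos (hb j hj)]
    have := mul_le_mul_of_nonneg_right (hSc j hj) (abs_nonneg (v j))
    linarith

end Loss

/-! ### Existence of a sparse solution in the interior of the feasible region -/

/-- Here `b` is a coordinate of the estimator, `s` of the truth, `z` the derivative of the penalty
at `b`, and `ω * lam` the noise level. The curvature `α > μ` compensates for the decay of `z`. The
delicate case is `0 ≤ s ≤ b`, with `d = b - s`, where the claim is `α d² + z d - lam d + (1 - ω) lam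
s ≥ 0`. -/
lemma shrinkage_real {μ α lam ω b s z : ℝ} (hμ : 0 ≤ μ) (hμα : μ < α) (hlam : 0 < lam)
    (hω0 : 0 ≤ ω) (hω1 : ω ≤ 1 / 3) (hω2 : ω * α ≤ α - μ) (hb : 0 < b) (hz0 : 0 ≤ z)
    (hz1 : z ≤ lam) (hz2 : lam - μ * b ≤ z) :
    (1 - ω) * lam * (b - 2 * |s|) ≤ α * (b - s) ^ 2 + z * (b - s) - ω * lam * |b - s| := by
  have hωl : 0 ≤ ω * lam := by positivity
  have h1ω : 0 ≤ (1 - ω) * lam := mul_nonneg (by linarith) hlam.le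
  rcases lt_or_ge s 0 with hs | hs
  · rw [abs_of_neg hs, abs_of_pos (by linarith : 0 < b - s)]
    have hd : 0 < b - s := by linarith
    have hsd : lam * (b - s) ≤ α * (b - s) ^ 2 + z * (b - s) := by
      have h1 : μ * (b - s) ^ 2 ≤ α * (b - s) ^ 2 :=
        mul_le_mul_of_nonneg_right hμα.le (sq_nonneg _)
      have h2 : (lam - μ * b) * (b - s) ≤ z * (b - s) := mul_le_mul_of_nonneg_right hz2 hd.le
      have h3 : 0 ≤ μ * -s * (b - s) := by
        have : 0 ≤ -s := by linarith
        positivity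
      nlinarith
    have h5 : 0 ≤ (1 - ω) * lam * -s := mul_nonneg h1ω (by linarith)
    nlinarith
  rw [abs_of_nonneg hs]
  rcases lt_or_ge b s with hbs | hbs
  · rw [abs_of_neg (by linarith : b - s < 0)]
    have h1 : z * (s - b) ≤ lam * (s - b) := mul_le_mul_of_nonneg_right hz1 (by linarith)
    have h2 : 0 ≤ α * (b - s) ^ 2 := mul_nonneg (by linarith) (sq_nonneg _)
    have h3 : 0 ≤ (1 / 3 - ω) * (lam * s) := mul_nonneg (by linarith) (by positivity)
    have h4 : 0 ≤ ω * lam * b := by positivity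
    have h5 : 0 ≤ lam * s := by positivity
    nlinarith
  obtain ⟨d, rfl⟩ : ∃ d, b = s + d := ⟨b - s, by ring⟩
  have hd : 0 ≤ d := by linarith
  have e : s + d - s = d := by ring
  rw [e, abs_of_nonneg hd]
  have hA : 0 < α - μ := by linarith
  rcases le_or_gt (μ * (s + d)) lam with hm | hm
  · suffices hq : 0 ≤ (α - μ) * d ^ 2 - μ * s * d + (1 - ω) * lam * s by
      have h2 : (lam - μ * (s + d)) * d ≤ z * d := mul_le_mul_of_nonneg_right hz2 hd
      nlinarith
    -- Either the quadratic in `d` has nonpositive discriminant, or `s` is so large that `ω lam ≤ μ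
    -- s`; then `μ (s + d) ≤ lam` gives `μ d ≤ (1 - ω) lam`, and the terms linear in `s` are
    -- nonnegative.
    rcases le_or_gt (μ ^ 2 * s) (4 * (α - μ) * ((1 - ω) * lam)) with hc | hc
    · have h1 : 0 ≤ s * (4 * (α - μ) * ((1 - ω) * lam) - μ ^ 2 * s) :=
        mul_nonneg hs (by linarith)
      have h2 : 0 ≤ 4 * (α - μ) * ((α - μ) * d ^ 2 - μ * s * d + (1 - ω) * lam * s) := by
        nlinarith [sq_nonneg (2 * (α - μ) * d - μ * s)]
      exact nonneg_of_mul_nonneg_right h2 (by linarith)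
    · have hμ0 : 0 < μ := by
        rcases hμ.eq_or_lt with h0 | h0
        · have : 0 ≤ 4 * (α - μ) * ((1 - ω) * lam) := mul_nonneg (by linarith) h1ω
          rw [← h0] at hc this
          linarith
        · exact h0
      have h1 : ω * μ ≤ α - μ := by nlinarith
      have h2 : 4 * (α - μ) * (2 / 3 * lam) ≤ 4 * (α - μ) * ((1 - ω) * lam) := by
        refine mul_le_mul_of_nonneg_left ?_ (by linarith)
        exact mul_le_mul_of_nonneg_right (by linarith) hlam.le
      have h3 : ω * μ * lam ≤ (α - μ) * lam := mul_le_mul_of_nonneg_right h1 hlam.le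
      have h4 : μ * (ω * lam) ≤ μ * (μ * s) := by nlinarith
      have h5 : ω * lam ≤ μ * s := le_of_mul_le_mul_left h4 hμ0
      have h6 : 0 ≤ s * ((1 - ω) * lam - μ * d) := mul_nonneg hs (by nlinarith)
      have h7 : 0 ≤ (α - μ) * d ^ 2 := by positivity
      nlinarith
  · have hμ0 : 0 < μ := by
      rcases hμ.eq_or_lt with h0 | h0
      · rw [← h0] at hm; linarith
      · exact h0
    suffices hq : 0 ≤ α * d ^ 2 - lam * d + (1 - ω) * lam * s by
      have h2 : 0 ≤ z * d := by positivity
      nlinarith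
    -- Past `lam / μ` only `z ≥ 0` is available. Using `μ s ≥ lam - μ d` leaves a quadratic in `μ
    -- d`; this is the sign of its discriminant, and where `ω α ≤ α - μ` is needed.
    have h1 : 0 ≤ 4 * (1 - ω) * (α - μ) - ω ^ 2 * μ := by
      have h2 : ω ^ 2 * μ ≤ 1 / 3 * (ω * α) := by
        have : ω ^ 2 * μ ≤ ω ^ 2 * α := mul_le_mul_of_nonneg_left hμα.le (sq_nonneg _)
        have : ω * (ω * α) ≤ 1 / 3 * (ω * α) :=
          mul_le_mul_of_nonneg_right hω1 (mul_nonneg hω0 (by linarith))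
        nlinarith
      have h3 : (2 / 3) * (α - μ) ≤ (1 - ω) * (α - μ) :=
        mul_le_mul_of_nonneg_right (by linarith) hA.le
      nlinarith
    have h2 : 0 ≤ 4 * α * (α * (μ * d) ^ 2 - (2 - ω) * μ * lam * (μ * d)
        + (1 - ω) * μ * lam ^ 2) := by
      have : 0 ≤ μ * lam ^ 2 * (4 * (1 - ω) * (α - μ) - ω ^ 2 * μ) :=
        mul_nonneg (by positivity) h1
      nlinarith [sq_nonneg (2 * α * (μ * d) - (2 - ω) * μ * lam)]
    have h3 : 0 ≤ α * (μ * d) ^ 2 - (2 - ω) * μ * lam * (μ * d) + (1 - ω) * μ * lam ^ 2 :=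
      nonneg_of_mul_nonneg_right h2 (by linarith)
    have h4 : (1 - ω) * lam * (lam - μ * d) ≤ (1 - ω) * lam * (μ * s) :=
      mul_le_mul_of_nonneg_left (by linarith) h1ω
    have h5 : 0 ≤ μ ^ 2 * (α * d ^ 2 - lam * d + (1 - ω) * lam * s) := by
      have := mul_le_mul_of_nonneg_left h4 hμ
      nlinarith
    exact nonneg_of_mul_nonneg_right h5 (by positivity)

namespace IsAmenable

variable {μ lam : ℝ} {rho : ℝ → ℝ}

lemma dirDeriv_neg (h : IsAmenable μ lam rho) (b v : ℝ) :
    dirDeriv lam rho (-b) (-v) = dirDeriv lam rho b v := by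
  unfold dirDeriv
  simp only [neg_eq_zero, abs_neg, h.deriv_neg]
  split_ifs <;> ring

lemma shrinkage (h : IsAmenable μ lam rho) {α ω : ℝ} (hμα : μ < α) (hlam : 0 < lam)
    (hω0 : 0 ≤ ω) (hω1 : ω ≤ 1 / 3) (hω2 : ω * α ≤ α - μ) (b s : ℝ) :
    (1 - ω) * lam * (|b| - 2 * |s|) ≤
      α * (b - s) ^ 2 - dirDeriv lam rho b (s - b) - ω * lam * |b - s| := by
  wlog hb : 0 ≤ b generalizing b s
  · have := this (-b) (-s) (by linarith)
    have e1 : -s - -b = -(s - b) := by ring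
    have e2 : -b - -s = -(b - s) := by ring
    rwa [e1, e2, h.dirDeriv_neg, abs_neg, abs_neg, abs_neg, neg_sq] at this
  rcases hb.eq_or_lt with rfl | hb
  · have h0 : 0 ≤ α * s ^ 2 := mul_nonneg (by linarith [h.mu_nonneg]) (sq_nonneg _)
    have h1 : 0 ≤ (1 / 3 - ω) * (lam * |s|) := mul_nonneg (by linarith) (by positivity)
    have h2 : 0 ≤ ω * (lam * |s|) := by positivity
    simp only [dirDeriv, if_true, sub_zero, zero_sub, abs_neg, abs_zero, neg_sq]
    nlinarith
  · have := shrinkage_real (s := s) h.mu_nonneg hμα hlam hω0 hω1 hω2 hb (h.deriv_nonneg hb)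
      (h.deriv_le hb) (h.le_deriv hb)
    rw [dirDeriv, if_neg hb.ne', abs_of_pos hb]
    linarith

end IsAmenable

section Existence

variable {n p : ℕ} (X : Matrix (Fin n) (Fin p) ℝ) (ε : Fin n → ℝ) (βs : Fin p → ℝ)

lemma lsGrad_linear_model (b : Fin p → ℝ) :
    lsGrad X (X *ᵥ βs + ε) b = sampleCov X *ᵥ (b - βs) - sampleCross X ε := by
  simp only [lsGrad, sampleCross, sampleCov, Matrix.mulVec_add, Matrix.mulVec_sub, smul_add,
    Matrix.smul_mulVec, Matrix.mulVec_mulVec]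
  abel

/-- The variational inequality tested at the truth bounds the summed right-hand side of `shrinkage`
by zero, the noise being controlled by Hölder's inequality. -/
lemma l1_le_of_variational {μ lam : ℝ} {rho : ℝ → ℝ} (h : IsAmenable μ lam rho) {α ω : ℝ}
    (hμα : μ < α) (hlam : 0 < lam) (hω0 : 0 ≤ ω) (hω1 : ω ≤ 1 / 3) (hω2 : ω * α ≤ α - μ)
    (hnoise : ∀ j, |sampleCross X ε j| ≤ ω * lam) (b : Fin p → ℝ)
    (hcurv : α * ((b - βs) ⬝ᵥ (b - βs)) ≤ (b - βs) ⬝ᵥ (sampleCov X *ᵥ (b - βs)))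
    (hvar : 0 ≤ lsGrad X (X *ᵥ βs + ε) b ⬝ᵥ (βs - b) +
      ∑ j, dirDeriv lam rho (b j) (βs j - b j)) :
    ∑ j, |b j| ≤ 2 * ∑ j, |βs j| := by
  have h1 : ∑ j, (1 - ω) * lam * (|b j| - 2 * |βs j|) ≤ ∑ j, (α * (b j - βs j) ^ 2 -
      dirDeriv lam rho (b j) (βs j - b j) - ω * lam * |b j - βs j|) :=
    Finset.sum_le_sum fun j _ => h.shrinkage hμα hlam hω0 hω1 hω2 (b j) (βs j)
  rw [← Finset.mul_sum, Finset.sum_sub_distrib, Finset.sum_sub_distrib, Finset.sum_sub_distrib,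
    ← Finset.mul_sum, ← Finset.mul_sum, ← Finset.mul_sum] at h1
  have e1 : (b - βs) ⬝ᵥ (b - βs) = ∑ j, (b j - βs j) ^ 2 :=
    Finset.sum_congr rfl fun j _ => by simp [sq]
  have e2 : lsGrad X (X *ᵥ βs + ε) b ⬝ᵥ (βs - b) =
      -((b - βs) ⬝ᵥ (sampleCov X *ᵥ (b - βs))) + sampleCross X ε ⬝ᵥ (b - βs) := by
    rw [lsGrad_linear_model, ← neg_sub b βs, dotProduct_neg, sub_dotProduct,
      dotProduct_comm _ (b - βs)]
    ring
  have h2 : sampleCross X ε ⬝ᵥ (b - βs) ≤ ω * lam * ∑ j, |b j - βs j| := by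
    rw [Finset.mul_sum]
    refine Finset.sum_le_sum fun j _ => ?_
    calc sampleCross X ε j * (b - βs) j ≤ |sampleCross X ε j| * |b j - βs j| := by
          rw [← abs_mul]; exact le_abs_self _
      _ ≤ _ := mul_le_mul_of_nonneg_right (hnoise j) (abs_nonneg _)
  rw [e1] at hcurv
  have h3 : (1 - ω) * lam * (∑ j, |b j| - 2 * ∑ j, |βs j|) ≤ 0 := by linarith
  have h4 : 0 < (1 - ω) * lam := mul_pos (by linarith) hlam
  have h5 := nonpos_of_mul_nonpos_right h3 h4
  linarith

lemma nonneg_of_hasDerivWithinAt_Ici {f : ℝ → ℝ} {f' : ℝ}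
    (hf : HasDerivWithinAt f f' (Set.Ici 0) 0) (hmin : ∀ t ∈ Set.Ioo (0 : ℝ) 1, f 0 ≤ f t) :
    0 ≤ f' := by
  have h1 := hasDerivWithinAt_iff_tendsto_slope' (s := Set.Ioi 0) (by simp) |>.1
      (hf.mono Set.Ioi_subset_Ici_self)
  refine ge_of_tendsto h1 ?_
  filter_upwards [Ioo_mem_nhdsGT (zero_lt_one' ℝ)] with t ht
  rw [slope_def_field]
  exact div_nonneg (by linarith [hmin t ht]) (by linarith [ht.1])

lemma variational_of_isMinOn {μ lam : ℝ} {rho : ℝ → ℝ} (h : IsAmenable μ lam rho)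
    (y : Fin n → ℝ) {K : Set (Fin p → ℝ)} (hK : Convex ℝ K) {b : Fin p → ℝ} (hb : b ∈ K)
    (hmin : IsMinOn (lsObjective X y rho) K b) {b' : Fin p → ℝ} (hb' : b' ∈ K) :
    0 ≤ lsGrad X y b ⬝ᵥ (b' - b) + ∑ j, dirDeriv lam rho (b j) (b' j - b j) := by
  have h1 := (hasDerivAt_lsLoss_line X y b (b' - b)).hasDerivWithinAt (s := Set.Ici 0)
  have h2 : HasDerivWithinAt (fun t : ℝ => ∑ j, rho (b j + t * (b' j - b j)))
      (∑ j, dirDeriv lam rho (b j) (b' j - b j)) (Set.Ici 0) 0 :=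
    HasDerivWithinAt.fun_sum fun j _ => h.hasDerivWithinAt_line (b j) (b' j - b j)
  refine nonneg_of_hasDerivWithinAt_Ici (h1.add h2) fun t ht => ?_
  have hmem : b + t • (b' - b) ∈ K := by
    have := hK hb hb' (by linarith [ht.2] : (0:ℝ) ≤ 1 - t) ht.1.le (by ring)
    convert this using 1
    ext j
    simp; ring
  have := hmin hmem
  simpa [lsObjective] using this

/-- The program restricted to vectors supported on `S` has a solution with small `ℓ₁` norm, and
this solution satisfies the first-order conditions on `S`. -/
lemma exists_restricted_solution {μ lam : ℝ} {rho : ℝ → ℝ} (h : IsAmenable μ lam rho) {α ω R : ℝ}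
    (hμα : μ < α) (hlam : 0 < lam) (hω0 : 0 ≤ ω) (hω1 : ω ≤ 1 / 3) (hω2 : ω * α ≤ α - μ)
    (hnoise : ∀ j, |sampleCross X ε j| ≤ ω * lam) (hR : 0 < R) (hβ : ∑ j, |βs j| ≤ R / 2)
    {S : Finset (Fin p)} (hβS : ∀ j ∉ S, βs j = 0)
    (hcurv : ∀ v : Fin p → ℝ, (∀ j ∉ S, v j = 0) →
      α * (v ⬝ᵥ v) ≤ v ⬝ᵥ (sampleCov X *ᵥ v)) :
    ∃ b : Fin p → ℝ, (∀ j ∉ S, b j = 0) ∧ ∑ j, |b j| ≤ R ∧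
      (∀ j ∈ S, b j ≠ 0 → lsGrad X (X *ᵥ βs + ε) b j = -deriv rho (b j)) ∧
      (∀ j ∈ S, b j = 0 → |lsGrad X (X *ᵥ βs + ε) b j| ≤ lam) := by
  -- The radius is `2 * R` rather than `R`: the minimizer turns out to have norm at most `R`, so
  -- moves of size `R` along any coordinate in `S` stay admissible and no multiplier for the ball
  -- appears.
  set K : Set (Fin p → ℝ) := {b | (∀ j ∉ S, b j = 0) ∧ ∑ j, |b j| ≤ 2 * R} with hK
  have hKc : IsCompact K := by
    refine Metric.isCompact_of_isClosed_isBounded ?_ ?_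
    · have e : K = (⋂ j, ⋂ _ : j ∉ S, {b | b j = 0}) ∩ {b | ∑ j, |b j| ≤ 2 * R} := by
        ext b; simp [hK]
      rw [e]
      refine IsClosed.inter (isClosed_iInter fun j => isClosed_iInter fun _ =>
        isClosed_eq (continuous_apply j) continuous_const) (isClosed_le
        (continuous_finsetSum _ fun j _ => (continuous_apply j).abs) continuous_const)
    · refine (Metric.isBounded_closedBall (x := (0 : Fin p → ℝ)) (r := 2 * R)).subset ?_
      intro b hb
      rw [mem_closedBall_zero_iff, pi_norm_le_iff_of_nonneg (by linarith)]
      intro j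
      exact (Finset.single_le_sum (f := fun j => |b j|) (fun i _ => abs_nonneg _)
        (Finset.mem_univ j)).trans hb.2
  have hKconv : Convex ℝ K := by
    intro a ha b hb s t hs ht hst
    refine ⟨fun j hj => by simp [ha.1 j hj, hb.1 j hj], ?_⟩
    have h1 : ∑ j, |(s • a + t • b) j| ≤ ∑ j, (s * |a j| + t * |b j|) := by
      refine Finset.sum_le_sum fun j _ => ?_
      refine (abs_add_le _ _).trans (le_of_eq ?_)
      simp [abs_mul, abs_of_nonneg hs, abs_of_nonneg ht]
    rw [Finset.sum_add_distrib, ← Finset.mul_sum, ← Finset.mul_sum] at h1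
    have h2 := mul_le_mul_of_nonneg_left ha.2 hs
    have h3 := mul_le_mul_of_nonneg_left hb.2 ht
    have h4 : s * (2 * R) + t * (2 * R) = 2 * R := by rw [← add_mul, hst, one_mul]
    linarith
  have hβK : βs ∈ K := ⟨hβS, by linarith⟩
  have hcont : Continuous (lsObjective X (X *ᵥ βs + ε) rho) := by
    have h1 := continuous_lsLoss X (X *ᵥ βs + ε)
    have h2 := h.continuous
    unfold lsObjective
    fun_prop
  obtain ⟨b, hb, hmin⟩ := hKc.exists_isMinOn ⟨βs, hβK⟩ hcont.continuousOn
  have hvar := fun b' hb' => variational_of_isMinOn X h _ hKconv hb hmin (b' := b') hb'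
  have hl1 : ∑ j, |b j| ≤ R := by
    refine (l1_le_of_variational X ε βs h hμα hlam hω0 hω1 hω2 hnoise b
      (hcurv _ fun j hj => by simp [hb.1 j hj, hβS j hj]) (hvar βs hβK)).trans (by linarith)
  have hcoord : ∀ j ∈ S, ∀ s : ℝ, |s| ≤ R →
      0 ≤ lsGrad X (X *ᵥ βs + ε) b j * s + dirDeriv lam rho (b j) s := by
    intro j hj s hs
    have hmem : b + (Pi.single j s : Fin p → ℝ) ∈ K := by
      refine ⟨fun i hi => ?_, ?_⟩
      · have : i ≠ j := fun hij => hi (hij ▸ hj)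
        simp [hb.1 i hi, this]
      · have h1 : ∑ i, |(b + (Pi.single j s : Fin p → ℝ)) i| ≤ ∑ i, (|b i| + |(Pi.single j s : Fin p → ℝ) i|) :=
          Finset.sum_le_sum fun i _ => abs_add_le _ _
        rw [Finset.sum_add_distrib] at h1
        have h2 : ∑ i, |(Pi.single j s : Fin p → ℝ) i| = |s| := by
          rw [Finset.sum_eq_single j] <;> simp +contextual
        linarith
    have h1 := hvar _ hmem
    have e : b + (Pi.single j s : Fin p → ℝ) - b = Pi.single j s := by abel
    rw [e, dotProduct_single] at h1
    have h2 : ∑ i, dirDeriv lam rho (b i) ((b + (Pi.single j s : Fin p → ℝ)) i - b i) =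
        dirDeriv lam rho (b j) s := by
      rw [Finset.sum_eq_single j]
      · simp
      · intro i _ hij
        simp [hij, dirDeriv]
      · simp
    rwa [h2] at h1
  refine ⟨b, hb.1, hl1, fun j hj hbj => ?_, fun j hj hbj => ?_⟩
  · have h1 := hcoord j hj R (abs_of_pos hR).le
    have h2 := hcoord j hj (-R) (by rw [abs_neg, abs_of_pos hR])
    simp only [dirDeriv, if_neg hbj] at h1 h2
    have h3 : 0 ≤ (lsGrad X (X *ᵥ βs + ε) b j + deriv rho (b j)) * R := by linarith
    have h4 : (lsGrad X (X *ᵥ βs + ε) b j + deriv rho (b j)) * R ≤ 0 := by linarith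
    have h5 := (mul_eq_zero.1 (le_antisymm h4 h3)).resolve_right hR.ne'
    linarith
  · have h1 := hcoord j hj R (abs_of_pos hR).le
    have h2 := hcoord j hj (-R) (by rw [abs_neg, abs_of_pos hR])
    simp only [dirDeriv, if_pos hbj, abs_neg, abs_of_pos hR] at h1 h2
    rw [abs_le]
    constructor
    · refine le_of_mul_le_mul_right ?_ hR; linarith
    · refine le_of_mul_le_mul_right ?_ hR; linarith

end Existence

/-! ### Consequences of restricted strong convexity -/

section RSC

variable {p : ℕ} {G : Matrix (Fin p) (Fin p) ℝ} {κ' τ L : ℝ} {S : Finset (Fin p)} {k : ℕ}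

lemma sq_sum_abs_le_card_mul (S : Finset (Fin p)) (hk : S.card ≤ k) (v : Fin p → ℝ) :
    (∑ j ∈ S, |v j|) ^ 2 ≤ k * (v ⬝ᵥ v) := by
  have h1 : (∑ j ∈ S, |v j|) ^ 2 ≤ S.card * ∑ j ∈ S, |v j| ^ 2 := sq_sum_le_card_mul_sum_sq
  have h2 : ∑ j ∈ S, |v j| ^ 2 ≤ v ⬝ᵥ v := by
    have : v ⬝ᵥ v = ∑ j, |v j| ^ 2 := Finset.sum_congr rfl fun j _ => by rw [sq_abs, sq]
    rw [this]
    exact Finset.sum_le_sum_of_subset_of_nonneg (Finset.subset_univ _) fun _ _ _ => sq_nonneg _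
  have h3 : 0 ≤ ∑ j ∈ S, |v j| ^ 2 := Finset.sum_nonneg fun _ _ => sq_nonneg _
  have h4 : (S.card : ℝ) ≤ k := by exact_mod_cast hk
  calc _ ≤ _ := h1
    _ ≤ k * ∑ j ∈ S, |v j| ^ 2 := mul_le_mul_of_nonneg_right h4 h3
    _ ≤ _ := mul_le_mul_of_nonneg_left h2 (by positivity)

lemma curvature_of_supported (hτ : 0 ≤ τ * L) (hk : S.card ≤ k)
    (hrsc : ∀ v : Fin p → ℝ, κ' * (v ⬝ᵥ v) - τ * L * (∑ j, |v j|) ^ 2 ≤ v ⬝ᵥ (G *ᵥ v))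
    {v : Fin p → ℝ} (hv : ∀ j ∉ S, v j = 0) :
    (κ' - τ * L * k) * (v ⬝ᵥ v) ≤ v ⬝ᵥ (G *ᵥ v) := by
  have h1 := hrsc v
  have h2 : ∑ j, |v j| = ∑ j ∈ S, |v j| :=
    (Finset.sum_subset (Finset.subset_univ S) fun j _ hj => by simp [hv j hj]).symm
  rw [h2] at h1
  have h3 := mul_le_mul_of_nonneg_left (sq_sum_abs_le_card_mul S hk v) hτ
  linarith

lemma curvature_of_l1_bounded {μ R c : ℝ} (hτ : 0 ≤ τ * L) (hk : S.card ≤ k)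
    (hrsc : ∀ v : Fin p → ℝ, κ' * (v ⬝ᵥ v) - τ * L * (∑ j, |v j|) ^ 2 ≤ v ⬝ᵥ (G *ᵥ v))
    (hc : 4 * R * (τ * L) ≤ c) {v : Fin p → ℝ} (hv : ∑ j, |v j| ≤ 2 * R) :
    (κ' - μ - 2 * (τ * L * k)) * (v ⬝ᵥ v) ≤
      v ⬝ᵥ (G *ᵥ v) - μ * (v ⬝ᵥ v) + c * ∑ j ∈ Sᶜ, |v j| := by
  have h1 := hrsc v
  rw [← Finset.sum_add_sum_compl S] at h1 hv
  have h3 := mul_le_mul_of_nonneg_left (sq_sum_abs_le_card_mul S hk v) hτ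
  have ha : 0 ≤ ∑ j ∈ S, |v j| := Finset.sum_nonneg fun _ _ => abs_nonneg _
  have hb : 0 ≤ ∑ j ∈ Sᶜ, |v j| := Finset.sum_nonneg fun _ _ => abs_nonneg _
  set a := ∑ j ∈ S, |v j|
  set b := ∑ j ∈ Sᶜ, |v j|
  -- The part off `S` is made linear through `b ≤ 2 * R`, so that the `ℓ₁` slack can absorb it; the
  -- part on `S` is paid for by sparsity.
  have h4 : (a + b) ^ 2 ≤ 2 * a ^ 2 + 2 * (2 * R * b) := by
    have : b ^ 2 ≤ 2 * R * b := by nlinarith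
    nlinarith [sq_nonneg (a - b)]
  have h5 := mul_le_mul_of_nonneg_left h4 hτ
  have h6 := mul_le_mul_of_nonneg_right hc hb
  nlinarith

end RSC

/-! ### Block computations and the deterministic part of the theorem -/

section Blocks

variable {n p : ℕ} {S : Finset (Fin p)}

/-- Extension of a vector indexed by `S` by zero. -/
def extendZero (S : Finset (Fin p)) (u : {j // j ∈ S} → ℝ) : Fin p → ℝ :=
  fun j => if h : j ∈ S then u ⟨j, h⟩ else 0

/-- Restriction of a vector to the coordinates in `S`. -/
def restr (S : Finset (Fin p)) (w : Fin p → ℝ) : {j // j ∈ S} → ℝ := fun j => w j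

lemma extendZero_of_notMem (u : {j // j ∈ S} → ℝ) {j : Fin p} (hj : j ∉ S) :
    extendZero S u j = 0 := by
  simp [extendZero, hj]

lemma extendZero_coe (u : {j // j ∈ S} → ℝ) (j : {j // j ∈ S}) : extendZero S u j = u j := by
  simp [extendZero]

lemma extendZero_restr {v : Fin p → ℝ} (hv : ∀ j ∉ S, v j = 0) :
    extendZero S (restr S v) = v := by
  ext j
  by_cases hj : j ∈ S
  · simp [extendZero, restr, hj]
  · rw [extendZero_of_notMem _ hj, hv j hj]

lemma dotProduct_extendZero (u : {j // j ∈ S} → ℝ) (w : Fin p → ℝ) :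
    w ⬝ᵥ extendZero S u = ∑ i : {j // j ∈ S}, w i * u i := by
  have h1 : w ⬝ᵥ extendZero S u = ∑ i ∈ S, w i * extendZero S u i :=
    (Finset.sum_subset (Finset.subset_univ S) fun j _ hj => by
      rw [extendZero_of_notMem _ hj, mul_zero]).symm
  rw [h1, ← Finset.sum_coe_sort]
  exact Finset.sum_congr rfl fun i _ => by rw [extendZero_coe]

lemma restr_mulVec_extendZero (A : Matrix (Fin p) (Fin p) ℝ) (u : {j // j ∈ S} → ℝ) :
    restr S (A *ᵥ extendZero S u) = blockSS A S *ᵥ u := by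
  ext j
  exact dotProduct_extendZero u (A j)

lemma mulVec_extendZero_of_notMem (A : Matrix (Fin p) (Fin p) ℝ) (u : {j // j ∈ S} → ℝ)
    (j : {j // j ∉ S}) : (A *ᵥ extendZero S u) j = (blockScS A S *ᵥ u) j :=
  dotProduct_extendZero u (A j)

lemma blockSS_transpose {A : Matrix (Fin p) (Fin p) ℝ} (hA : Aᵀ = A) :
    (blockSS A S)ᵀ = blockSS A S := by
  conv_rhs => rw [← hA]
  rfl

attribute [local instance] Matrix.linftyOpNormedAddCommGroup in
lemma abs_mulVec_le_opNormInf {m l : Type*} [Fintype m] [Fintype l] (A : Matrix m l ℝ)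
    {u : l → ℝ} {c : ℝ} (hc : 0 ≤ c) (hu : ∀ i, |u i| ≤ c) (i : m) :
    |(A *ᵥ u) i| ≤ opNormInf A * c := by
  have h1 : ‖A *ᵥ u‖ ≤ ‖A‖ * ‖u‖ := Matrix.linfty_opNorm_mulVec A u
  have h2 : ‖u‖ ≤ c := (pi_norm_le_iff_of_nonneg hc).2 hu
  have h3 : ‖(A *ᵥ u) i‖ ≤ ‖A *ᵥ u‖ := norm_le_pi_norm _ i
  calc |(A *ᵥ u) i| ≤ ‖A‖ * ‖u‖ := h3.trans h1
    _ ≤ opNormInf A * c := mul_le_mul_of_nonneg_left h2 (norm_nonneg _)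

attribute [local instance] Matrix.linftyOpNormedAddCommGroup in
lemma opNormInf_nonneg {m l : Type*} [Fintype m] [Fintype l] (A : Matrix m l ℝ) :
    0 ≤ opNormInf A := norm_nonneg _

/-- The vector `a` such that `a ⬝ᵥ (Xᵀε / n)` is the `j`-th coordinate of
`(A_SS)⁻¹ (Xᵀε / n)_S`. -/
noncomputable def noiseDirS (A : Matrix (Fin p) (Fin p) ℝ) (S : Finset (Fin p)) (j : Fin p) :
    Fin p → ℝ :=
  if h : j ∈ S then extendZero S ((blockSS A S)⁻¹ ⟨j, h⟩) else 0

/-- The vector `a` such that `a ⬝ᵥ (Xᵀε / n)` is the `j`-th coordinate of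
`(Xᵀε / n)_{Sᶜ} - A_{SᶜS} (A_SS)⁻¹ (Xᵀε / n)_S`. -/
noncomputable def noiseDirSc (A : Matrix (Fin p) (Fin p) ℝ) (S : Finset (Fin p)) (j : Fin p) :
    Fin p → ℝ :=
  if h : j ∉ S then
    Pi.single j 1 - extendZero S ((blockScS A S * (blockSS A S)⁻¹) ⟨j, h⟩) else 0

lemma noiseDirS_dotProduct (A : Matrix (Fin p) (Fin p) ℝ) (j : {j // j ∈ S}) (w : Fin p → ℝ) :
    noiseDirS A S j ⬝ᵥ w = ((blockSS A S)⁻¹ *ᵥ restr S w) j := by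
  rw [noiseDirS, dif_pos j.2, dotProduct_comm, dotProduct_extendZero]
  exact Finset.sum_congr rfl fun i _ => mul_comm _ _

lemma noiseDirSc_dotProduct (A : Matrix (Fin p) (Fin p) ℝ) (j : {j // j ∉ S}) (w : Fin p → ℝ) :
    noiseDirSc A S j ⬝ᵥ w =
      w j - ((blockScS A S * (blockSS A S)⁻¹) *ᵥ restr S w) j := by
  rw [noiseDirSc, dif_pos j.2, sub_dotProduct, single_dotProduct, one_mul,
    dotProduct_comm (extendZero _ _), dotProduct_extendZero]
  congr 1
  exact Finset.sum_congr rfl fun i _ => mul_comm _ _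

variable (X : Matrix (Fin n) (Fin p) ℝ)

/-- The direction `a` solves `Γa = e_j` on `S`, hence `aᵀΓa = a_j`. Curvature gives `α a_j² ≤ α‖a‖²
≤ a_j`, so `a_j ≤ 1/α`. -/
lemma quad_noiseDirS_le (hM : IsUnit (blockSS (sampleCov X) S)) {α : ℝ} (hα : 0 < α)
    (hcurv : ∀ v : Fin p → ℝ, (∀ j ∉ S, v j = 0) → α * (v ⬝ᵥ v) ≤ v ⬝ᵥ (sampleCov X *ᵥ v))
    (j : Fin p) :
    noiseDirS (sampleCov X) S j ⬝ᵥ (sampleCov X *ᵥ noiseDirS (sampleCov X) S j) ≤ 1 / α := by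
  by_cases hj : j ∈ S
  swap
  · simp only [noiseDirS, dif_neg hj, zero_dotProduct]; positivity
  set M := blockSS (sampleCov X) S with hMdef
  set a := noiseDirS (sampleCov X) S j with ha
  have hsupp : ∀ i ∉ S, a i = 0 := fun i hi => by
    rw [ha, noiseDirS, dif_pos hj, extendZero_of_notMem _ hi]
  have hdet : IsUnit M.det := (Matrix.isUnit_iff_isUnit_det M).1 hM
  have hsym : (M⁻¹)ᵀ = M⁻¹ := by
    rw [Matrix.transpose_nonsing_inv, hMdef, blockSS_transpose (sampleCov_transpose X)]
  have hGa : restr S (sampleCov X *ᵥ a) = Pi.single ⟨j, hj⟩ 1 := by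
    rw [ha, noiseDirS, dif_pos hj, restr_mulVec_extendZero]
    have e : M⁻¹ ⟨j, hj⟩ = M⁻¹ *ᵥ Pi.single ⟨j, hj⟩ 1 := by
      rw [Matrix.mulVec_single_one]
      ext i
      have := congrFun (congrFun hsym i) ⟨j, hj⟩
      exact this
    rw [← hMdef, e, Matrix.mulVec_mulVec, Matrix.mul_nonsing_inv M hdet, Matrix.one_mulVec]
  have hq : a ⬝ᵥ (sampleCov X *ᵥ a) = a j := by
    conv_lhs => rw [← extendZero_restr hsupp]
    rw [extendZero_restr hsupp, dotProduct_comm]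
    conv_lhs => rw [← extendZero_restr hsupp]
    rw [dotProduct_extendZero, extendZero_restr hsupp]
    have : ∀ i : {j // j ∈ S}, (sampleCov X *ᵥ a) i = (Pi.single ⟨j, hj⟩ 1 : {j // j ∈ S} → ℝ) i :=
      fun i => congrFun hGa i
    simp only [this]
    rw [Finset.sum_eq_single ⟨j, hj⟩]
    · simp [restr]
    · intro i _ hi; simp [hi]
    · simp
  have h1 := hcurv a hsupp
  rw [hq] at h1 ⊢
  have h2 : a j * a j ≤ a ⬝ᵥ a :=
    Finset.single_le_sum (f := fun i => a i * a i) (fun i _ => mul_self_nonneg _)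
      (Finset.mem_univ j)
  rw [le_div_iff₀ hα]
  by_contra hcon
  push Not at hcon
  have h3 : 0 < a j := pos_of_mul_pos_left (by linarith) hα.le
  nlinarith [mul_le_mul_of_nonneg_left h2 hα.le]

/-- The direction `a` is the residual of the `Γ`-orthogonal projection of `e_j` onto vectors
supported in `S`, so Pythagoras gives `aᵀΓa ≤ e_jᵀΓe_j`. -/
lemma quad_noiseDirSc_le (hM : IsUnit (blockSS (sampleCov X) S)) (j : Fin p) :
    noiseDirSc (sampleCov X) S j ⬝ᵥ (sampleCov X *ᵥ noiseDirSc (sampleCov X) S j) ≤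
      sampleCov X j j := by
  have hjj : ∀ i : Fin p, (Pi.single i 1 : Fin p → ℝ) ⬝ᵥ (sampleCov X *ᵥ Pi.single i 1) =
      sampleCov X i i := fun i => by
    rw [single_dotProduct, Matrix.mulVec_single_one, one_mul]; rfl
  by_cases hj : j ∈ S
  · simp only [noiseDirSc, not_not.2 hj, dif_neg, not_false_eq_true, zero_dotProduct]
    rw [← hjj]; exact quad_sampleCov_nonneg X _
  set M := blockSS (sampleCov X) S with hMdef
  set a := noiseDirSc (sampleCov X) S j with ha
  set b := extendZero S ((blockScS (sampleCov X) S * M⁻¹) ⟨j, hj⟩) with hb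
  have hab : a = Pi.single j 1 - b := by rw [ha, noiseDirSc, dif_pos hj]
  have hdet : IsUnit M.det := (Matrix.isUnit_iff_isUnit_det M).1 hM
  have hGa : restr S (sampleCov X *ᵥ a) = 0 := by
    have h1 : restr S (sampleCov X *ᵥ b) = restr S (sampleCov X *ᵥ Pi.single j 1) := by
      rw [hb, restr_mulVec_extendZero, ← hMdef]
      have e1 : (blockScS (sampleCov X) S * M⁻¹) ⟨j, hj⟩ =
          blockScS (sampleCov X) S ⟨j, hj⟩ ᵥ* M⁻¹ := rfl
      have e2 : Mᵀ = M := blockSS_transpose (sampleCov_transpose X)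
      rw [e1]
      have e3 : ∀ w, M *ᵥ w = w ᵥ* M := fun w => by rw [← Matrix.mulVec_transpose, e2]
      rw [e3, Matrix.vecMul_vecMul, Matrix.nonsing_inv_mul M hdet,
        Matrix.vecMul_one, Matrix.mulVec_single_one]
      ext i
      exact congrFun (congrFun (sampleCov_transpose X) i) j
    rw [hab, Matrix.mulVec_sub]
    ext i
    have := congrFun h1 i
    simp only [restr] at this
    simp [restr, this]
  have hbGa : b ⬝ᵥ (sampleCov X *ᵥ a) = 0 := by
    rw [dotProduct_comm, hb, dotProduct_extendZero]
    refine Finset.sum_eq_zero fun i _ => ?_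
    have := congrFun hGa i
    simp only [restr, Pi.zero_apply] at this
    rw [this, zero_mul]
  have hsum : (Pi.single j 1 : Fin p → ℝ) = a + b := by rw [hab]; abel
  rw [← hjj j, hsum, Matrix.mulVec_add, dotProduct_add, add_dotProduct, add_dotProduct, hbGa,
    dotProduct_sampleCov_comm X a b, hbGa]
  linarith [quad_sampleCov_nonneg X b]

end Blocks

section Deterministic

variable {n p : ℕ} {S : Finset (Fin p)} (X : Matrix (Fin n) (Fin p) ℝ) (ε : Fin n → ℝ)
  (βs : Fin p → ℝ)

lemma error_eq_of_supported (hM : IsUnit (blockSS (sampleCov X) S)) {b : Fin p → ℝ}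
    (hb : ∀ j ∉ S, b j = 0) (hβ : ∀ j ∉ S, βs j = 0) :
    restr S (b - βs) = (blockSS (sampleCov X) S)⁻¹ *ᵥ
      (restr S (lsGrad X (X *ᵥ βs + ε) b) + restr S (sampleCross X ε)) := by
  have hdet := (Matrix.isUnit_iff_isUnit_det _).1 hM
  have hv : ∀ j ∉ S, (b - βs) j = 0 := fun j hj => by simp [hb j hj, hβ j hj]
  have h1 : restr S (lsGrad X (X *ᵥ βs + ε) b) + restr S (sampleCross X ε) =
      blockSS (sampleCov X) S *ᵥ restr S (b - βs) := by
    rw [← restr_mulVec_extendZero, extendZero_restr hv, lsGrad_linear_model]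
    ext i; simp [restr]
  rw [h1, Matrix.mulVec_mulVec, Matrix.nonsing_inv_mul _ hdet, Matrix.one_mulVec]

lemma error_apply_of_supported (hM : IsUnit (blockSS (sampleCov X) S)) {b : Fin p → ℝ}
    (hb : ∀ j ∉ S, b j = 0) (hβ : ∀ j ∉ S, βs j = 0) (j : {j // j ∈ S}) :
    b j - βs j =
      ((blockSS (sampleCov X) S)⁻¹ *ᵥ restr S (lsGrad X (X *ᵥ βs + ε) b)) j +
        noiseDirS (sampleCov X) S j ⬝ᵥ sampleCross X ε := by
  have h := congrFun (error_eq_of_supported X ε βs hM hb hβ) j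
  rw [Matrix.mulVec_add, Pi.add_apply, ← noiseDirS_dotProduct _ _ (sampleCross X ε)] at h
  exact h

/-- Eliminating the error on `S` expresses the gradient off `S` through the gradient on `S`,
multiplied by the incoherence matrix, and a residual noise term. -/
lemma lsGrad_apply_of_notMem (hM : IsUnit (blockSS (sampleCov X) S)) {b : Fin p → ℝ}
    (hb : ∀ j ∉ S, b j = 0) (hβ : ∀ j ∉ S, βs j = 0) (j : {j // j ∉ S}) :
    lsGrad X (X *ᵥ βs + ε) b j =
      ((blockScS (sampleCov X) S * (blockSS (sampleCov X) S)⁻¹) *ᵥ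
        restr S (lsGrad X (X *ᵥ βs + ε) b)) j -
        noiseDirSc (sampleCov X) S j ⬝ᵥ sampleCross X ε := by
  have hv : ∀ j ∉ S, (b - βs) j = 0 := fun j hj => by simp [hb j hj, hβ j hj]
  have h1 : lsGrad X (X *ᵥ βs + ε) b j =
      (blockScS (sampleCov X) S *ᵥ restr S (b - βs)) j - sampleCross X ε j := by
    rw [← mulVec_extendZero_of_notMem, extendZero_restr hv, lsGrad_linear_model]
    rfl
  rw [h1, error_eq_of_supported X ε βs hM hb hβ, noiseDirSc_dotProduct, Matrix.mulVec_mulVec,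
    Matrix.mulVec_add, Pi.add_apply]
  ring

/-- The deterministic part of the support recovery theorem under incoherence. -/
lemma support_recovery_of_incoherence {μ lam κ' T α ω δ R t cinf η : ℝ} {k : ℕ} {rho : ℝ → ℝ}
    (h : IsAmenable μ lam rho) (hlam : 0 < lam) (hT : 0 ≤ T) (hk : S.card ≤ k)
    (hrsc : ∀ v : Fin p → ℝ,
      κ' * (v ⬝ᵥ v) - T * (∑ j, |v j|) ^ 2 ≤ v ⬝ᵥ (sampleCov X *ᵥ v))
    (hμα : μ < α) (hα : α ≤ κ' - T * k) (hc : 0 < κ' - μ - 2 * (T * k))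
    (hδ : 0 ≤ δ) (hRT : 4 * R * T ≤ δ * lam) (hω0 : 0 ≤ ω) (hω1 : ω ≤ 1 / 3)
    (hω2 : ω * α ≤ α - μ) (hR : 0 < R) (hβ : ∑ j, |βs j| ≤ R / 2) (hβS : ∀ j ∉ S, βs j = 0)
    (hnoise : ∀ j, |sampleCross X ε j| ≤ ω * lam)
    (hnoiseS : ∀ j, |noiseDirS (sampleCov X) S j ⬝ᵥ sampleCross X ε| ≤ t)
    (hnoiseSc : ∀ j, |noiseDirSc (sampleCov X) S j ⬝ᵥ sampleCross X ε| ≤ δ * lam) (ht : 0 ≤ t)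
    (hinv : InvBound (sampleCov X) S cinf)
    (hinc : opNormInf (blockScS (sampleCov X) S * (blockSS (sampleCov X) S)⁻¹) ≤ η)
    (hηδ : η + δ ≤ 1 - δ) :
    ∃ βh : Fin p → ℝ,
      (∀ b, IsStationaryPoint X (X *ᵥ βs + ε) rho R b ↔ b = βh) ∧
      IsMinOn (lsObjective X (X *ᵥ βs + ε) rho) (l1Ball p R) βh ∧
      (∀ j ∉ S, βh j = 0) ∧ ∀ j, |βh j - βs j| ≤ t + cinf * lam := by
  have hcurv : ∀ v : Fin p → ℝ, (∀ j ∉ S, v j = 0) →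
      α * (v ⬝ᵥ v) ≤ v ⬝ᵥ (sampleCov X *ᵥ v) := fun v hv => by
    have h1 := curvature_of_supported (L := 1) (τ := T) (by linarith) hk
      (fun v => by simpa using hrsc v) hv
    have h0 : 0 ≤ v ⬝ᵥ v := Finset.sum_nonneg fun i _ => mul_self_nonneg _
    have := mul_le_mul_of_nonneg_right hα h0
    simp only [mul_one] at h1
    linarith
  obtain ⟨b, hbS, hbR, hne, heq⟩ := exists_restricted_solution X ε βs h hμα hlam hω0 hω1 hω2
    hnoise hR hβ hβS hcurv
  have hgS : ∀ i, |restr S (lsGrad X (X *ᵥ βs + ε) b) i| ≤ lam := by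
    intro i
    by_cases h0 : b i = 0
    · exact heq i i.2 h0
    · change |lsGrad X (X *ᵥ βs + ε) b i| ≤ lam
      rw [hne i i.2 h0, abs_neg]
      exact h.abs_deriv_le h0
  have hgSc : ∀ j ∉ S, |lsGrad X (X *ᵥ βs + ε) b j| ≤ (1 - δ) * lam := by
    intro j hj
    rw [lsGrad_apply_of_notMem X ε βs hinv.1 hbS hβS ⟨j, hj⟩]
    have h1 := abs_mulVec_le_opNormInf (blockScS (sampleCov X) S * (blockSS (sampleCov X) S)⁻¹)
      hlam.le hgS ⟨j, hj⟩
    have h2 := hnoiseSc j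
    have h3 := mul_le_mul_of_nonneg_right hinc hlam.le
    have h4 := mul_le_mul_of_nonneg_right hηδ hlam.le
    refine (abs_sub _ _).trans ?_
    linarith
  have hδl : 0 ≤ δ * lam := by positivity
  obtain ⟨hu, hmin⟩ := stationary_unique_of_margin X (X *ᵥ βs + ε) h (S := S) hc hδl hbR
    (margin_of_coord (fun j hj => hne j (by by_contra hjS; exact hj (hbS j hjS)) hj)
      (fun j hj => by
        by_cases hjS : j ∈ S
        · exact heq j hjS hj
        · exact (hgSc j hjS).trans (by linarith)) hbS hgSc)
    (fun v hv => by
      have := curvature_of_l1_bounded (L := 1) (τ := T) (S := S) (k := k) (μ := μ) (R := R)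
        (c := δ * lam) (by linarith) hk (fun v => by simpa using hrsc v) (by simpa using hRT) hv
      simpa using this)
  refine ⟨b, hu, hmin, hbS, fun j => ?_⟩
  have hcinf : 0 ≤ cinf := (opNormInf_nonneg _).trans hinv.2
  by_cases hj : j ∈ S
  · have h1 := error_apply_of_supported X ε βs hinv.1 hbS hβS ⟨j, hj⟩
    have h2 := abs_mulVec_le_opNormInf (blockSS (sampleCov X) S)⁻¹ hlam.le hgS ⟨j, hj⟩
    have h3 := mul_le_mul_of_nonneg_right hinv.2 hlam.le
    have h4 := hnoiseS j
    simp only at h1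
    rw [h1]
    refine (abs_add_le _ _).trans ?_
    linarith
  · rw [hbS j hj, hβS j hj, sub_self, abs_zero]
    positivity

/-- The deterministic part of the oracle theorem. -/
lemma oracle_of_unbiased {μ γ lam κ' T δ R t cinf : ℝ} {k : ℕ} {rho : ℝ → ℝ}
    (h : IsUnbiasedAmenable μ γ lam rho) (hlam : 0 < lam) (hT : 0 ≤ T) (hk : S.card ≤ k)
    (hrsc : ∀ v : Fin p → ℝ,
      κ' * (v ⬝ᵥ v) - T * (∑ j, |v j|) ^ 2 ≤ v ⬝ᵥ (sampleCov X *ᵥ v))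
    (hκ : T * k < κ') (hc : 0 < κ' - μ - 2 * (T * k))
    (hδ : 0 ≤ δ) (hRT : 4 * R * T ≤ δ * lam) (hδ2 : δ ≤ 1 / 2)
    (hβ : ∑ j, |βs j| ≤ R / 2) (hβS : ∀ j ∉ S, βs j = 0)
    (hnoiseS : ∀ j, |noiseDirS (sampleCov X) S j ⬝ᵥ sampleCross X ε| ≤ t)
    (hnoiseSc : ∀ j, |noiseDirSc (sampleCov X) S j ⬝ᵥ sampleCross X ε| ≤ δ * lam) (ht : 0 ≤ t)
    (hinv : InvBound (sampleCov X) S cinf)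
    (hsignal : ∀ j ∈ S, lam * (γ + cinf) + t ≤ |βs j|) :
    ∃ βh : Fin p → ℝ,
      (∀ b, IsStationaryPoint X (X *ᵥ βs + ε) rho R b ↔ b = βh) ∧
      (∀ b, IsOracle X (X *ᵥ βs + ε) S b ↔ b = βh) ∧ ∀ j, |βh j - βs j| ≤ t := by
  have hcinf : 0 ≤ cinf := (opNormInf_nonneg _).trans hinv.2
  have hdet := (Matrix.isUnit_iff_isUnit_det _).1 hinv.1
  set M := blockSS (sampleCov X) S with hM
  set y := X *ᵥ βs + ε with hy
  -- The solution of the normal equations on `S`.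
  set b := βs + extendZero S (M⁻¹ *ᵥ restr S (sampleCross X ε)) with hb
  have hbS : ∀ j ∉ S, b j = 0 := fun j hj => by
    rw [hb, Pi.add_apply, hβS j hj, extendZero_of_notMem _ hj, add_zero]
  have hgS : restr S (lsGrad X y b) = 0 := by
    have e : lsGrad X y b = sampleCov X *ᵥ extendZero S (M⁻¹ *ᵥ restr S (sampleCross X ε)) -
        sampleCross X ε := by
      rw [hy, lsGrad_linear_model, hb]; congr 2; abel
    have e2 : restr S (lsGrad X y b) = restr S (sampleCov X *ᵥ extendZero S
        (M⁻¹ *ᵥ restr S (sampleCross X ε))) - restr S (sampleCross X ε) := by rw [e]; rfl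
    rw [e2, restr_mulVec_extendZero, Matrix.mulVec_mulVec, Matrix.mul_nonsing_inv _ hdet,
      Matrix.one_mulVec, sub_self]
  have hgS' : ∀ j ∈ S, lsGrad X y b j = 0 := fun j hj => congrFun hgS ⟨j, hj⟩
  have herr : ∀ j, |b j - βs j| ≤ t := by
    intro j
    by_cases hj : j ∈ S
    · have h1 := error_apply_of_supported X ε βs hinv.1 hbS hβS ⟨j, hj⟩
      rw [← hy, hgS, Matrix.mulVec_zero, Pi.zero_apply, zero_add] at h1
      simp only at h1
      rw [h1]
      exact hnoiseS j
    · rw [hbS j hj, hβS j hj, sub_self, abs_zero]; exact ht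
  have hγ := h.gamma_pos
  have hbig : ∀ j ∈ S, γ * lam ≤ |b j| := by
    intro j hj
    have h1 := hsignal j hj
    have h2 := herr j
    have h3 : |βs j| ≤ |b j| + |b j - βs j| := by
      have := abs_sub (b j) (b j - βs j)
      rwa [sub_sub_cancel] at this
    have := mul_nonneg hlam.le hcinf
    linarith
  have hbne : ∀ j ∈ S, b j ≠ 0 := fun j hj h0 => by
    have := hbig j hj
    rw [h0, abs_zero] at this
    have := mul_pos hγ hlam
    linarith
  have hderiv : ∀ j ∈ S, deriv rho (b j) = 0 := by
    intro j hj
    have h1 := h.unbiased _ (hbig j hj)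
    rcases abs_choice (b j) with h2 | h2 <;> rw [h2] at h1
    · exact h1
    · rw [h.toIsAmenable.deriv_neg] at h1; linarith
  have hbR : b ∈ l1Ball p R := by
    change ∑ j, |b j| ≤ R
    -- The signal condition also yields feasibility: on `S` the error `t` is at most `|βs j|`.
    have h1 : ∑ j, |b j| ≤ ∑ j, 2 * |βs j| := by
      refine Finset.sum_le_sum fun j _ => ?_
      by_cases hj : j ∈ S
      · have h2 := hsignal j hj
        have h3 := herr j
        have h4 : |b j| ≤ |βs j| + |b j - βs j| := by
          have := abs_add_le (βs j) (b j - βs j)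
          rwa [add_sub_cancel] at this
        have : 0 ≤ lam * (γ + cinf) := by positivity
        linarith
      · rw [hbS j hj, abs_zero]; positivity
    rw [← Finset.mul_sum] at h1
    linarith
  have hgSc : ∀ j ∉ S, |lsGrad X y b j| ≤ (1 - δ) * lam := by
    intro j hj
    have e := lsGrad_apply_of_notMem X ε βs hinv.1 hbS hβS ⟨j, hj⟩
    rw [← hy, hgS, Matrix.mulVec_zero, Pi.zero_apply, zero_sub] at e
    simp only at e
    rw [e, abs_neg]
    refine (hnoiseSc j).trans (mul_le_mul_of_nonneg_right (by linarith) hlam.le)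
  have hδl : 0 ≤ δ * lam := by positivity
  obtain ⟨hu, -⟩ := stationary_unique_of_margin X y h.toIsAmenable (S := S) hc hδl hbR
    (margin_of_coord (fun j hj => by
        have hjS : j ∈ S := by by_contra hjS; exact hj (hbS j hjS)
        rw [hgS' j hjS, hderiv j hjS, neg_zero])
      (fun j hj => by
        have hjS : j ∉ S := fun hjS => hbne j hjS hj
        exact (hgSc j hjS).trans (by linarith)) hbS hgSc)
    (fun v hv => by
      have := curvature_of_l1_bounded (L := 1) (τ := T) (S := S) (k := k) (μ := μ) (R := R)
        (c := δ * lam) (by linarith) hk (fun v => by simpa using hrsc v) (by simpa using hRT) hv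
      simpa using this)
  have hexp : ∀ b' : Fin p → ℝ, supp b' ⊆ S → lsLoss X y b' = lsLoss X y b +
      1 / 2 * ((b' - b) ⬝ᵥ (sampleCov X *ᵥ (b' - b))) := by
    intro b' hb'
    have e : b' = b + (b' - b) := by abel
    have h0 : lsGrad X y b ⬝ᵥ (b' - b) = 0 := by
      refine Finset.sum_eq_zero fun j _ => ?_
      by_cases hj : j ∈ S
      · rw [hgS' j hj, zero_mul]
      · have : b' j = 0 := by
          by_contra hne
          exact hj (hb' (by simp [supp, hne]))
        rw [Pi.sub_apply, this, hbS j hj, sub_self, mul_zero]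
    conv_lhs => rw [e, lsLoss_add, h0]
    ring
  have hbsupp : supp b ⊆ S := by
    intro j hj
    by_contra hjS
    simp [supp, hbS j hjS] at hj
  refine ⟨b, hu, fun b' => ⟨fun hO => ?_, ?_⟩, herr⟩
  · have h1 := hO.2 b hbsupp
    rw [hexp b' hO.1] at h1
    have hv : ∀ j ∉ S, (b' - b) j = 0 := fun j hj => by
      have : b' j = 0 := by
        by_contra hne
        exact hj (hO.1 (by simp [supp, hne]))
      rw [Pi.sub_apply, this, hbS j hj, sub_self]
    have h2 := curvature_of_supported (L := 1) (τ := T) (by linarith) hk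
      (fun v => by simpa using hrsc v) hv
    simp only [mul_one] at h2
    have h0 : 0 ≤ (b' - b) ⬝ᵥ (b' - b) := Finset.sum_nonneg fun i _ => mul_self_nonneg _
    have h3 : (b' - b) ⬝ᵥ (b' - b) = 0 := by
      refine le_antisymm ?_ h0
      have h4 : (κ' - T * k) * ((b' - b) ⬝ᵥ (b' - b)) ≤ 0 := by linarith
      exact nonpos_of_mul_nonpos_right h4 (by linarith)
    rw [dotProduct_self_eq_zero] at h3
    exact sub_eq_zero.1 h3
  · rintro rfl
    refine ⟨hbsupp, fun b' hb' => ?_⟩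
    rw [hexp b' hb']
    linarith [quad_sampleCov_nonneg X (b' - b)]

end Deterministic

/-! ### Squares of sub-Gaussian random variables -/

section Squares

lemma lintegral_exp_sq_div_four_gaussianReal :
    ∫⁻ g, ENNReal.ofReal (Real.exp (g ^ 2 / 4)) ∂gaussianReal 0 1 ≤ 2 := by
  rw [gaussianReal_of_var_ne_zero 0 one_ne_zero,
    lintegral_withDensity_eq_lintegral_mul _ (measurable_gaussianPDF 0 1) (by fun_prop)]
  have e : ∀ g : ℝ, (gaussianPDF 0 1 * fun g => ENNReal.ofReal (Real.exp (g ^ 2 / 4))) g =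
      ENNReal.ofReal ((√(2 * Real.pi))⁻¹ * Real.exp (-(1 / 4) * g ^ 2)) := by
    intro g
    rw [Pi.mul_apply, gaussianPDF, ← ENNReal.ofReal_mul (gaussianPDFReal_nonneg 0 1 g),
      gaussianPDFReal]
    congr 1
    rw [mul_assoc, ← Real.exp_add]
    congr 2
    · simp
    · simp; ring
  simp_rw [e]
  rw [← ofReal_integral_eq_lintegral_ofReal
    ((integrable_exp_neg_mul_sq (by norm_num)).const_mul _)
    (Eventually.of_forall fun g => by positivity), integral_const_mul, integral_gaussian]
  have h2 : (√(2 * Real.pi))⁻¹ * √(Real.pi / (1 / 4)) ≤ 2 := by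
    have hpi := Real.pi_pos
    rw [inv_mul_le_iff₀ (by positivity), Real.sqrt_le_left (by positivity), mul_pow,
      Real.sq_sqrt (by positivity)]
    linarith
  calc ENNReal.ofReal ((√(2 * Real.pi))⁻¹ * √(Real.pi / (1 / 4))) ≤ ENNReal.ofReal 2 :=
        ENNReal.ofReal_le_ofReal h2
    _ = 2 := by norm_num

variable {Ω : Type*} [MeasurableSpace Ω] {P : Measure Ω} [IsProbabilityMeasure P]

/-- Gaussian linearization: `exp (r² Z² / 2)` is the mean of `exp (r Z g)` over a standard Gaussian
`g`. After exchanging the integrals, the sub-Gaussian bound leaves the mean of `exp (g² / 4)`, which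
is `√2`. -/
lemma lintegral_exp_sq_le {Z : Ω → ℝ} {c : ℝ≥0} (hc : c ≠ 0) (hm : Measurable Z)
    (hZ : HasSubgaussianMGF Z c P) :
    ∫⁻ ω, ENNReal.ofReal (Real.exp (1 / (4 * c) * Z ω ^ 2)) ∂P ≤ 2 := by
  have hc0 : (0 : ℝ) < c := by exact_mod_cast pos_iff_ne_zero.2 hc
  set r : ℝ := √(1 / (2 * c)) with hr
  have hr2 : r ^ 2 = 1 / (2 * c) := Real.sq_sqrt (by positivity)
  have h1 : ∀ ω, ENNReal.ofReal (Real.exp (1 / (4 * c) * Z ω ^ 2)) =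
      ∫⁻ g, ENNReal.ofReal (Real.exp (r * Z ω * g)) ∂gaussianReal 0 1 := by
    intro ω
    rw [← ofReal_integral_eq_lintegral_ofReal (integrable_exp_mul_gaussianReal _)
      (Eventually.of_forall fun g => by positivity)]
    have := congrFun (mgf_fun_id_gaussianReal (μ := 0) (v := 1)) (r * Z ω)
    rw [mgf] at this
    rw [this]
    congr 2
    rw [mul_pow, hr2]
    simp only [NNReal.coe_one]
    field_simp
    ring
  simp_rw [h1]
  rw [lintegral_lintegral_swap (by fun_prop)]
  refine le_trans (lintegral_mono fun g => ?_) lintegral_exp_sq_div_four_gaussianReal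
  have e : ∀ ω, r * Z ω * g = (r * g) * Z ω := fun ω => by ring
  simp_rw [e]
  rw [← ofReal_integral_eq_lintegral_ofReal (hZ.integrable_exp_mul _)
      (Eventually.of_forall fun g => by positivity)]
  refine ENNReal.ofReal_le_ofReal ((hZ.mgf_le (r * g)).trans (le_of_eq ?_))
  congr 1
  rw [mul_pow, hr2]
  field_simp
  ring

variable {Z : Ω → ℝ} {c : ℝ≥0}

lemma integrable_exp_sq (hc : c ≠ 0) (hm : Measurable Z) (hZ : HasSubgaussianMGF Z c P) :
    Integrable (fun ω => Real.exp (1 / (4 * c) * Z ω ^ 2)) P := by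
  refine ⟨by fun_prop, ?_⟩
  rw [hasFiniteIntegral_iff_ofReal (Eventually.of_forall fun ω => by positivity)]
  exact (lintegral_exp_sq_le hc hm hZ).trans_lt (by norm_num)

lemma mgf_sq_le_two (hc : c ≠ 0) (hm : Measurable Z) (hZ : HasSubgaussianMGF Z c P) :
    mgf (fun ω => Z ω ^ 2) P (1 / (4 * c)) ≤ 2 := by
  rw [mgf, integral_eq_lintegral_of_nonneg_ae (Eventually.of_forall fun ω => by positivity)
    (by fun_prop)]
  exact ENNReal.toReal_le_of_le_ofReal (by norm_num)
    ((lintegral_exp_sq_le hc hm hZ).trans (by norm_num))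

lemma pow_four_le_exp {c z : ℝ} (hc : 0 < c) :
    (z ^ 2) ^ 2 ≤ 32 * c ^ 2 * Real.exp (1 / (4 * c) * z ^ 2) := by
  have h1 := Real.quadratic_le_exp_of_nonneg (x := 1 / (4 * c) * z ^ 2) (by positivity)
  have h2 : (1 / (4 * c) * z ^ 2) ^ 2 / 2 ≤ Real.exp (1 / (4 * c) * z ^ 2) := by
    have : 0 ≤ 1 / (4 * c) * z ^ 2 := by positivity
    linarith
  have e : (z ^ 2) ^ 2 = 32 * c ^ 2 * ((1 / (4 * c) * z ^ 2) ^ 2 / 2) := by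
    field_simp; ring
  rw [e]
  exact mul_le_mul_of_nonneg_left h2 (by positivity)

lemma integrable_sq_sq (hc : c ≠ 0) (hm : Measurable Z) (hZ : HasSubgaussianMGF Z c P) :
    Integrable (fun ω => (Z ω ^ 2) ^ 2) P := by
  have hc0 : (0 : ℝ) < c := by exact_mod_cast pos_iff_ne_zero.2 hc
  refine ((integrable_exp_sq hc hm hZ).const_mul (32 * (c : ℝ) ^ 2)).mono' (by fun_prop)
    (Eventually.of_forall fun ω => ?_)
  rw [Real.norm_of_nonneg (by positivity)]
  exact pow_four_le_exp hc0

lemma integral_sq_sq_le (hc : c ≠ 0) (hm : Measurable Z) (hZ : HasSubgaussianMGF Z c P) :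
    ∫ ω, (Z ω ^ 2) ^ 2 ∂P ≤ 64 * (c : ℝ) ^ 2 := by
  have hc0 : (0 : ℝ) < c := by exact_mod_cast pos_iff_ne_zero.2 hc
  have h1 : ∫ ω, (Z ω ^ 2) ^ 2 ∂P ≤
      ∫ ω, 32 * (c : ℝ) ^ 2 * Real.exp (1 / (4 * c) * Z ω ^ 2) ∂P :=
    integral_mono (integrable_sq_sq hc hm hZ) ((integrable_exp_sq hc hm hZ).const_mul _)
      fun ω => pow_four_le_exp hc0
  rw [integral_const_mul] at h1
  have h2 : ∫ ω, Real.exp (1 / (4 * c) * Z ω ^ 2) ∂P ≤ 2 := mgf_sq_le_two hc hm hZ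
  nlinarith [sq_nonneg (c : ℝ)]

lemma exp_neg_le_quadratic {x : ℝ} (hx : 0 ≤ x) : Real.exp (-x) ≤ 1 - x + x ^ 2 / 2 := by
  have h1 := Real.quadratic_le_exp_of_nonneg hx
  have h2 : 0 < 1 - x + x ^ 2 / 2 := by nlinarith [sq_nonneg (x - 1)]
  rw [Real.exp_neg, inv_le_iff_one_le_mul₀ (Real.exp_pos x)]
  calc (1 : ℝ) ≤ (1 - x + x ^ 2 / 2) * (1 + x + x ^ 2 / 2) := by nlinarith [sq_nonneg (x ^ 2)]
    _ ≤ _ := mul_le_mul_of_nonneg_left h1 h2.le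

/-- For the lower tail of a nonnegative variable, `exp (-x) ≤ 1 - x + x² / 2` reduces the bound to
the second and fourth moments of `Z`, for every `t ≥ 0`. -/
lemma mgf_sq_neg_le (hc : c ≠ 0) (hm : Measurable Z) (hZ : HasSubgaussianMGF Z c P) {κ t : ℝ}
    (hκ : κ ≤ ∫ ω, Z ω ^ 2 ∂P) (ht : 0 ≤ t) :
    mgf (fun ω => Z ω ^ 2) P (-t) ≤ Real.exp (-t * κ + 32 * (c : ℝ) ^ 2 * t ^ 2) := by
  have hi4 := integrable_sq_sq hc hm hZ
  have hi2 : Integrable (fun ω => Z ω ^ 2) P := by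
    have := (hZ.memLp 2).integrable_sq
    exact this
  have hle : ∀ ω, Real.exp (-t * Z ω ^ 2) ≤ 1 - t * Z ω ^ 2 + t ^ 2 / 2 * (Z ω ^ 2) ^ 2 := by
    intro ω
    have := exp_neg_le_quadratic (x := t * Z ω ^ 2) (by positivity)
    rw [← neg_mul] at this
    refine this.trans (le_of_eq (by ring))
  have hint : Integrable (fun ω => 1 - t * Z ω ^ 2 + t ^ 2 / 2 * (Z ω ^ 2) ^ 2) P :=
    Integrable.add (f := fun ω => 1 - t * Z ω ^ 2) ((integrable_const 1).sub (hi2.const_mul t))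
      (hi4.const_mul _)
  have h1 : mgf (fun ω => Z ω ^ 2) P (-t) ≤
      ∫ ω, (1 - t * Z ω ^ 2 + t ^ 2 / 2 * (Z ω ^ 2) ^ 2) ∂P :=
    integral_mono_of_nonneg (Eventually.of_forall fun ω => by positivity) hint
      (Eventually.of_forall hle)
  rw [integral_add (f := fun ω => 1 - t * Z ω ^ 2) ((integrable_const 1).sub (hi2.const_mul t)) (hi4.const_mul _),
    integral_sub (integrable_const 1) (hi2.const_mul t), integral_const_mul, integral_const_mul,
    integral_const, probReal_univ, one_smul] at h1
  have h2 := integral_sq_sq_le hc hm hZ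
  have h3 := Real.add_one_le_exp (-t * κ + 32 * (c : ℝ) ^ 2 * t ^ 2)
  have h4 := mul_le_mul_of_nonneg_left hκ ht
  have h5 := mul_le_mul_of_nonneg_left h2 (by positivity : 0 ≤ t ^ 2 / 2)
  linarith

variable {n : ℕ} {W : Fin n → Ω → ℝ}

/-- Lower tail of a sum of squares of independent sub-Gaussian variables. -/
lemma measureReal_sum_sq_le (hc : c ≠ 0) (hind : iIndepFun W P) (hm : ∀ i, Measurable (W i))
    (hW : ∀ i, HasSubgaussianMGF (W i) c P) {κ a : ℝ} (hκ : ∀ i, κ ≤ ∫ ω, W i ω ^ 2 ∂P)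
    (ha : a ≤ κ) :
    P.real {ω | ∑ i, W i ω ^ 2 ≤ n * a} ≤ Real.exp (-((κ - a) ^ 2 / (128 * (c : ℝ) ^ 2) * n)) := by
  have hc0 : (0 : ℝ) < c := by exact_mod_cast pos_iff_ne_zero.2 hc
  have hind2 : iIndepFun (fun i ω => W i ω ^ 2) P := hind.comp (fun _ z => z ^ 2) fun _ => by fun_prop
  -- The minimizer of the Chernoff exponent `-t (κ - a) + 32 c² t²`.
  set t : ℝ := (κ - a) / (64 * (c : ℝ) ^ 2) with ht
  have ht0 : 0 ≤ t := div_nonneg (by linarith) (by positivity)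
  have hmgf : mgf (∑ i, fun ω => W i ω ^ 2) P (-t) ≤
      Real.exp (-t * κ + 32 * (c : ℝ) ^ 2 * t ^ 2) ^ n := by
    rw [hind2.mgf_sum (fun i => by have := hm i; fun_prop)]
    refine (Finset.prod_le_prod (fun i _ => mgf_nonneg) fun i _ =>
      mgf_sq_neg_le hc (hm i) (hW i) (hκ i) ht0).trans ?_
    simp
  have hbdd : Integrable (fun ω => Real.exp (-t * (∑ i, fun ω => W i ω ^ 2) ω)) P := by
    refine Integrable.of_bound (C := 1) ?_ (Eventually.of_forall fun ω => ?_)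
    · simp only [Finset.sum_apply]
      have := hm
      exact (by fun_prop : Measurable _).aestronglyMeasurable
    · rw [Real.norm_of_nonneg (by positivity), Real.exp_le_one_iff, Finset.sum_apply]
      have : 0 ≤ ∑ i, W i ω ^ 2 := Finset.sum_nonneg fun i _ => sq_nonneg _
      nlinarith
  have h1 := measure_le_le_exp_mul_mgf (n * a) (by linarith : -t ≤ 0) hbdd
  have e : {ω | ∑ i, W i ω ^ 2 ≤ n * a} = {ω | (∑ i, fun ω => W i ω ^ 2) ω ≤ n * a} := by
    ext ω; simp [Finset.sum_apply]
  rw [e]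
  refine h1.trans ((mul_le_mul_of_nonneg_left hmgf (by positivity)).trans (le_of_eq ?_))
  rw [← Real.exp_nat_mul, ← Real.exp_add]
  congr 1
  rw [ht]
  field_simp
  ring

/-- Upper tail of a sum of squares of independent sub-Gaussian variables. -/
lemma measureReal_sum_sq_ge (hc : c ≠ 0) (hind : iIndepFun W P) (hm : ∀ i, Measurable (W i))
    (hW : ∀ i, HasSubgaussianMGF (W i) c P) :
    P.real {ω | n * (8 * (c : ℝ)) ≤ ∑ i, W i ω ^ 2} ≤ Real.exp (-n) := by
  have hc0 : (0 : ℝ) < c := by exact_mod_cast pos_iff_ne_zero.2 hc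
  have hind2 : iIndepFun (fun i ω => W i ω ^ 2) P := hind.comp (fun _ z => z ^ 2) fun _ => by fun_prop
  have hmgf : mgf (∑ i, fun ω => W i ω ^ 2) P (1 / (4 * c)) ≤ 2 ^ n := by
    rw [hind2.mgf_sum (fun i => by have := hm i; fun_prop)]
    refine (Finset.prod_le_prod (fun i _ => mgf_nonneg) fun i _ =>
      mgf_sq_le_two hc (hm i) (hW i)).trans ?_
    simp
  have hint : Integrable (fun ω => Real.exp (1 / (4 * c) * (∑ i, fun ω => W i ω ^ 2) ω)) P :=
    hind2.integrable_exp_mul_sum (fun i => by have := hm i; fun_prop)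
      fun i _ => integrable_exp_sq hc (hm i) (hW i)
  have h1 := measure_ge_le_exp_mul_mgf (n * (8 * (c : ℝ)))
    (by positivity : (0 : ℝ) ≤ 1 / (4 * c)) hint
  have e : {ω | n * (8 * (c : ℝ)) ≤ ∑ i, W i ω ^ 2} =
      {ω | n * (8 * (c : ℝ)) ≤ (∑ i, fun ω => W i ω ^ 2) ω} := by
    ext ω; simp [Finset.sum_apply]
  rw [e]
  have h2 : (2 : ℝ) ^ n ≤ Real.exp n := by
    rw [← mul_one (n : ℝ), Real.exp_nat_mul]
    exact pow_le_pow_left₀ (by norm_num) (by have := Real.add_one_le_exp (1 : ℝ); linarith) n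
  refine h1.trans ((mul_le_mul_of_nonneg_left (hmgf.trans h2) (by positivity)).trans (le_of_eq ?_))
  rw [← Real.exp_add]
  congr 1
  field_simp
  ring

end Squares

/-! ### Restricted strong convexity from sums of signed basis vectors -/

section Maurey

variable {p : ℕ}

/-- The signed standard basis vectors. -/
def signedBasis (a : Fin p × Bool) : Fin p → ℝ := Pi.single a.1 (if a.2 then 1 else -1)

lemma quad_signedBasis (D : Matrix (Fin p) (Fin p) ℝ) (a : Fin p × Bool) :
    signedBasis a ⬝ᵥ (D *ᵥ signedBasis a) = D a.1 a.1 := by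
  rw [signedBasis, single_dotProduct, Matrix.mulVec_single]
  split_ifs <;> simp

lemma quad_add_smul (D : Matrix (Fin p) (Fin p) ℝ) (y u : Fin p → ℝ) :
    (y + u) ⬝ᵥ (D *ᵥ (y + u)) =
      y ⬝ᵥ (D *ᵥ y) + (D *ᵥ y + y ᵥ* D) ⬝ᵥ u + u ⬝ᵥ (D *ᵥ u) := by
  rw [Matrix.mulVec_add, dotProduct_add, add_dotProduct, add_dotProduct, add_dotProduct,
    ← Matrix.dotProduct_mulVec, dotProduct_comm u (D *ᵥ y)]
  ring

/-- Replacing, one at a time, the summands of a sum of vectors by their mean. -/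
lemma quad_mean_nonneg {ι : Type*} [Fintype ι] (e : ι → Fin p → ℝ) (w : ι → ℝ)
    (hw0 : ∀ a, 0 ≤ w a) (hw1 : ∑ a, w a = 1) (D : Matrix (Fin p) (Fin p) ℝ) {C : ℝ}
    (hC : ∀ a, e a ⬝ᵥ (D *ᵥ e a) ≤ C) {m : ℕ}
    (hD : ∀ s : Fin m → ι, 0 ≤ (∑ i, e (s i)) ⬝ᵥ (D *ᵥ ∑ i, e (s i))) (l : ℕ) :
    ∀ r : ℕ, r + l = m → ∀ s : Fin r → ι,
      0 ≤ (∑ i, e (s i) + (l : ℝ) • ∑ a, w a • e a) ⬝ᵥ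
          (D *ᵥ (∑ i, e (s i) + (l : ℝ) • ∑ a, w a • e a)) +
        l * (C - (∑ a, w a • e a) ⬝ᵥ (D *ᵥ ∑ a, w a • e a)) := by
  set v := ∑ a, w a • e a with hv
  induction l with
  | zero =>
    intro r hr s
    obtain rfl : r = m := by omega
    simpa using hD s
  | succ l ih =>
    intro r hr s
    set y := ∑ i, e (s i) + (l : ℝ) • v with hy
    have h1 : ∀ a, 0 ≤ (y + e a) ⬝ᵥ (D *ᵥ (y + e a)) + l * (C - v ⬝ᵥ (D *ᵥ v)) := by
      intro a
      have h := ih (r + 1) (by omega) (Fin.cons a s)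
      have e1 : ∑ i, e ((Fin.cons a s : Fin (r + 1) → ι) i) + (l : ℝ) • v = y + e a := by
        rw [Fin.sum_univ_succ, hy]
        simp only [Fin.cons_zero, Fin.cons_succ]
        abel
      rwa [e1] at h
    -- Averaging over the last summand turns the cross term into that of the mean `v`. Only the
    -- square of the summand changes, from at most `C` to `v ⬝ᵥ (D *ᵥ v)`, so each replacement costs
    -- the difference.
    have h2 : 0 ≤ ∑ a, w a * ((y + e a) ⬝ᵥ (D *ᵥ (y + e a)) + l * (C - v ⬝ᵥ (D *ᵥ v))) :=
      Finset.sum_nonneg fun a _ => mul_nonneg (hw0 a) (h1 a)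
    have h3 : ∑ a, w a * ((y + e a) ⬝ᵥ (D *ᵥ (y + e a)) + l * (C - v ⬝ᵥ (D *ᵥ v))) ≤
        ∑ a, (w a * (y ⬝ᵥ (D *ᵥ y) + C + l * (C - v ⬝ᵥ (D *ᵥ v))) +
          (D *ᵥ y + y ᵥ* D) ⬝ᵥ (w a • e a)) := by
      refine Finset.sum_le_sum fun a _ => ?_
      rw [quad_add_smul, dotProduct_smul, smul_eq_mul]
      nlinarith [mul_le_mul_of_nonneg_left (hC a) (hw0 a)]
    rw [Finset.sum_add_distrib, ← Finset.sum_mul, hw1, ← dotProduct_sum, ← hv] at h3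
    have e2 : ∑ i, e (s i) + ((l + 1 : ℕ) : ℝ) • v = y + v := by
      rw [hy]; push_cast; rw [add_smul, one_smul]; abel
    rw [e2, quad_add_smul]
    push_cast
    linarith

lemma sum_weights_signedBasis (v : Fin p → ℝ) :
    ∑ a : Fin p × Bool, (if a.2 = decide (0 ≤ v a.1) then |v a.1| else 0) • signedBasis a = v := by
  rw [Fintype.sum_prod_type]
  ext i
  rw [Finset.sum_apply, Finset.sum_eq_single i]
  · rcases le_or_gt 0 (v i) with h | h
    · simp [signedBasis, h, abs_of_nonneg h]
    · simp [signedBasis, not_le.2 h, abs_of_neg h]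
  · intro j _ hj
    have : ∀ r : ℝ, (Pi.single j r : Fin p → ℝ) i = 0 := fun r => by simp [Ne.symm hj]
    simp only [Fintype.sum_bool, signedBasis, Pi.add_apply, Pi.smul_apply, this, smul_zero,
      add_zero]
  · simp

lemma sum_weights (v : Fin p → ℝ) :
    ∑ a : Fin p × Bool, (if a.2 = decide (0 ≤ v a.1) then |v a.1| else 0) = ∑ j, |v j| := by
  rw [Fintype.sum_prod_type]
  refine Finset.sum_congr rfl fun i _ => ?_
  rcases le_or_gt 0 (v i) with h | h
  · simp [h]
  · simp [not_le.2 h]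

/-- A quadratic form which is nonnegative on sums of `m` signed basis vectors is bounded below in
terms of the `ℓ₁` norm. -/
lemma quad_ge_of_sums_signedBasis (D : Matrix (Fin p) (Fin p) ℝ) {C : ℝ} (hC : ∀ j, D j j ≤ C)
    {m : ℕ} (hm : 2 ≤ m)
    (hD : ∀ s : Fin m → Fin p × Bool,
      0 ≤ (∑ i, signedBasis (s i)) ⬝ᵥ (D *ᵥ ∑ i, signedBasis (s i))) (v : Fin p → ℝ) :
    -(C / (m - 1) * (∑ j, |v j|) ^ 2) ≤ v ⬝ᵥ (D *ᵥ v) := by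
  have hm1 : (1 : ℝ) ≤ (m : ℝ) - 1 := by
    have : (2 : ℝ) ≤ m := by exact_mod_cast hm
    linarith
  set N := ∑ j, |v j| with hN
  have hN0 : 0 ≤ N := Finset.sum_nonneg fun _ _ => abs_nonneg _
  rcases hN0.eq_or_lt with h0 | h0
  · have : v = 0 := by
      ext j
      have := (Finset.sum_eq_zero_iff_of_nonneg (fun i _ => abs_nonneg (v i))).1 h0.symm j
        (Finset.mem_univ j)
      simpa using this
    rw [← h0, this]; simp
  set w : Fin p × Bool → ℝ :=
    fun a => N⁻¹ * (if a.2 = decide (0 ≤ v a.1) then |v a.1| else 0) with hw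
  have hw0 : ∀ a, 0 ≤ w a := fun a => mul_nonneg (by positivity) (by split_ifs <;> positivity)
  have hw1 : ∑ a, w a = 1 := by
    rw [hw, ← Finset.mul_sum, sum_weights, ← hN, inv_mul_cancel₀ h0.ne']
  have hwv : ∑ a, w a • signedBasis a = N⁻¹ • v := by
    conv_rhs => rw [← sum_weights_signedBasis v]
    rw [Finset.smul_sum]
    exact Finset.sum_congr rfl fun a _ => by rw [hw, mul_smul]
  have h := quad_mean_nonneg signedBasis w hw0 hw1 D (C := C)
    (fun a => by rw [quad_signedBasis]; exact hC a.1) hD m 0 (by omega) Fin.elim0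
  rw [hwv] at h
  simp only [Finset.univ_eq_empty, Finset.sum_empty, zero_add, Matrix.mulVec_smul,
    dotProduct_smul, smul_dotProduct, smul_eq_mul] at h
  -- With `q' = q / N²`, replacing all `m` summands gives `m² q' + m (C - q') ≥ 0`, that is `(m - 1)
  -- q' + C ≥ 0`.
  set q := v ⬝ᵥ (D *ᵥ v)
  have hm0 : (0 : ℝ) < m := by linarith
  have h2 : 0 ≤ (m : ℝ) * ((m - 1) * (N⁻¹ * (N⁻¹ * q)) + C) := by linarith
  have h3 := nonneg_of_mul_nonneg_right h2 hm0
  have h4 : (m - 1 : ℝ) * (N⁻¹ * (N⁻¹ * q)) + C = ((m - 1) / N ^ 2) * (q + C / (m - 1) * N ^ 2) := by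
    have : (m : ℝ) - 1 ≠ 0 := by linarith
    field_simp
  rw [h4] at h3
  have h5 := nonneg_of_mul_nonneg_right h3 (by positivity)
  linarith

end Maurey

/-! ### Restricted strong convexity of a sub-Gaussian design -/

section Design

lemma le_quad_of_le_lambdaMin {p : ℕ} {A : Matrix (Fin p) (Fin p) ℝ} (hA : A.IsHermitian) {κ : ℝ}
    (hκ : κ ≤ lambdaMin A) (u : Fin p → ℝ) : κ * (u ⬝ᵥ u) ≤ u ⬝ᵥ (A *ᵥ u) := by
  have hspec : ∀ r ∈ spectrum ℝ A, κ ≤ r := fun r hr =>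
    hκ.trans (csInf_le (Matrix.finite_real_spectrum (A := A)).bddBelow hr)
  have hB : (A - algebraMap ℝ (Matrix (Fin p) (Fin p) ℝ) κ).IsHermitian := by
    refine hA.sub ?_
    rw [Matrix.algebraMap_eq_diagonal]
    exact Matrix.isHermitian_diagonal _
  have hpos : (A - algebraMap ℝ (Matrix (Fin p) (Fin p) ℝ) κ).PosSemidef := by
    rw [hB.posSemidef_iff_eigenvalues_nonneg]
    intro i
    have h1 := hB.eigenvalues_mem_spectrum_real i
    have h2 : κ + hB.eigenvalues i ∈ spectrum ℝ A := by
      rw [← spectrum.sub_singleton_eq, Set.sub_singleton] at h1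
      obtain ⟨r, hr, hr2⟩ := h1
      rw [← hr2]; simpa using hr
    have := hspec _ h2
    simp only [Pi.zero_apply]; linarith
  have h := hpos.dotProduct_mulVec_nonneg u
  rw [Matrix.sub_mulVec, dotProduct_sub, Algebra.algebraMap_eq_smul_one, Matrix.smul_mulVec,
    Matrix.one_mulVec, dotProduct_smul, smul_eq_mul, star_trivial] at h
  linarith

lemma quad_designMatrix {Ω : Type*} {n p : ℕ} (x : Fin n → Ω → Fin p → ℝ) (u : Fin p → ℝ) (ω : Ω) :
    u ⬝ᵥ (sampleCov (designMatrix x ω) *ᵥ u) = (n : ℝ)⁻¹ * ∑ i, (u ⬝ᵥ x i ω) ^ 2 := by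
  rw [dotProduct_sampleCov]
  congr 1
  refine Finset.sum_congr rfl fun i _ => ?_
  rw [sq, dotProduct_comm u]
  rfl

variable {Ω : Type*} [MeasurableSpace Ω] {P : Measure Ω} {n p : ℕ}
  {x : Fin n → Ω → Fin p → ℝ} {ε : Fin n → Ω → ℝ} {Sig : Matrix (Fin p) (Fin p) ℝ} {σx σε : ℝ≥0}

lemma ProbabilityTheory.HasSubgaussianMGF.mono_param {Z : Ω → ℝ} {c d : ℝ≥0}
    (h : HasSubgaussianMGF Z c P) (hcd : c ≤ d) : HasSubgaussianMGF Z d P where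
  integrable_exp_mul := h.integrable_exp_mul
  mgf_le t := (h.mgf_le t).trans (Real.exp_le_exp.2 (by
    have : (c : ℝ) ≤ d := by exact_mod_cast hcd
    have := mul_le_mul_of_nonneg_right this (sq_nonneg t)
    linarith))

namespace IsSubGaussianDesign

lemma subGaussian_coord (h : IsSubGaussianDesign P x ε Sig σx σε) (i : Fin n) (j : Fin p) :
    HasSubgaussianMGF (fun ω => x i ω j) (σx ^ 2) P := by
  have := h.subGaussian_x i (Pi.single j 1) (by simp)
  simpa using this

lemma isHermitian (h : IsSubGaussianDesign P x ε Sig σx σε) (i : Fin n) : Sig.IsHermitian := by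
  ext j l
  rw [Matrix.conjTranspose_apply, star_trivial, ← h.cov_x i, ← h.cov_x i, covariance_comm]

lemma measurable_proj (h : IsSubGaussianDesign P x ε Sig σx σε) (i : Fin n) (u : Fin p → ℝ) :
    Measurable fun ω => u ⬝ᵥ x i ω := by
  have := h.measurable_x i
  simp only [dotProduct]
  fun_prop

/-- The second moment dominates the variance `uᵀ Sig u`, which is at least the smallest eigenvalue.
-/
lemma le_integral_sq [IsProbabilityMeasure P] (h : IsSubGaussianDesign P x ε Sig σx σε) {κ : ℝ} (hκ : κ ≤ lambdaMin Sig)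
    (i : Fin n) {u : Fin p → ℝ} (hu : u ⬝ᵥ u = 1) : κ ≤ ∫ ω, (u ⬝ᵥ x i ω) ^ 2 ∂P := by
  have h1 := le_quad_of_le_lambdaMin (h.isHermitian i) hκ u
  rw [hu, mul_one] at h1
  have hL : ∀ j, MemLp (fun ω => u j * x i ω j) 2 P := fun j =>
    ((h.subGaussian_coord i j).memLp 2).const_mul (u j)
  have h2 : covariance (fun ω => u ⬝ᵥ x i ω) (fun ω => u ⬝ᵥ x i ω) P = u ⬝ᵥ (Sig *ᵥ u) := by
    simp only [dotProduct, Matrix.mulVec]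
    rw [covariance_fun_sum_left hL (memLp_finsetSum _ fun j _ => hL j)]
    refine Finset.sum_congr rfl fun j _ => ?_
    rw [covariance_fun_sum_right hL (hL j), Finset.mul_sum]
    refine Finset.sum_congr rfl fun l _ => ?_
    rw [covariance_const_mul_left, covariance_const_mul_right, h.cov_x]
    ring
  rw [covariance_self (h.measurable_proj i u).aemeasurable] at h2
  rw [← h2] at h1
  exact h1.trans (variance_le_expectation_sq (h.measurable_proj i u).aestronglyMeasurable)

lemma iIndepFun_proj (h : IsSubGaussianDesign P x ε Sig σx σε) (u : Fin p → ℝ) :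
    iIndepFun (fun i ω => u ⬝ᵥ x i ω) P :=
  h.indep.comp (fun _ (z : (Fin p → ℝ) × ℝ) => u ⬝ᵥ z.1) fun _ => by
    simp only [dotProduct]
    fun_prop

lemma measureReal_quad_le [IsProbabilityMeasure P] (h : IsSubGaussianDesign P x ε Sig σx σε) {s : ℝ≥0} (hs : s ≠ 0)
    (hσ : σx ^ 2 ≤ s) (hn : 0 < n) {κ a : ℝ} (hκ : κ ≤ lambdaMin Sig) (ha : a ≤ κ)
    {u : Fin p → ℝ} (hu : u ≠ 0) :
    P.real {ω | u ⬝ᵥ (sampleCov (designMatrix x ω) *ᵥ u) < a * (u ⬝ᵥ u)} ≤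
      Real.exp (-((κ - a) ^ 2 / (128 * (s : ℝ) ^ 2) * n)) := by
  have hn0 : (0 : ℝ) < n := by exact_mod_cast hn
  have huu : 0 < u ⬝ᵥ u := lt_of_le_of_ne (Finset.sum_nonneg fun i _ => mul_self_nonneg _)
    (fun h0 => hu (dotProduct_self_eq_zero.1 h0.symm))
  set r := (√(u ⬝ᵥ u))⁻¹ with hr
  have hr2 : r * r = (u ⬝ᵥ u)⁻¹ := by
    rw [hr, ← mul_inv, Real.mul_self_sqrt huu.le]
  have hu1 : (r • u) ⬝ᵥ (r • u) = 1 := by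
    rw [smul_dotProduct, dotProduct_smul, smul_eq_mul, smul_eq_mul, ← mul_assoc, hr2,
      inv_mul_cancel₀ huu.ne']
  refine le_trans (measureReal_mono ?_) (measureReal_sum_sq_le (W := fun i ω => (r • u) ⬝ᵥ x i ω)
    hs (h.iIndepFun_proj _) (fun i => h.measurable_proj i _)
    (fun i => (h.subGaussian_x i _ hu1).mono_param hσ) (fun i => h.le_integral_sq hκ i hu1) ha)
  intro ω hω
  have hω : u ⬝ᵥ (sampleCov (designMatrix x ω) *ᵥ u) < a * (u ⬝ᵥ u) := hω
  change ∑ i, ((r • u) ⬝ᵥ x i ω) ^ 2 ≤ n * a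
  have h1 := quad_designMatrix x (r • u) ω
  rw [Matrix.mulVec_smul, smul_dotProduct, dotProduct_smul, smul_eq_mul, smul_eq_mul, ← mul_assoc,
    hr2] at h1
  rw [← inv_mul_le_iff₀ hn0, ← h1, inv_mul_le_iff₀ huu]
  linarith

lemma measureReal_diag_ge [IsProbabilityMeasure P] (h : IsSubGaussianDesign P x ε Sig σx σε) {s : ℝ≥0} (hs : s ≠ 0)
    (hσ : σx ^ 2 ≤ s) (hn : 0 < n) (j : Fin p) :
    P.real {ω | 8 * (s : ℝ) < sampleCov (designMatrix x ω) j j} ≤ Real.exp (-n) := by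
  have hn0 : (0 : ℝ) < n := by exact_mod_cast hn
  have hu1 : (Pi.single j 1 : Fin p → ℝ) ⬝ᵥ Pi.single j 1 = 1 := by simp
  refine le_trans (measureReal_mono ?_) (measureReal_sum_sq_ge
    (W := fun i ω => (Pi.single j 1 : Fin p → ℝ) ⬝ᵥ x i ω)
    hs (h.iIndepFun_proj _) (fun i => h.measurable_proj i _)
    (fun i => (h.subGaussian_x i _ hu1).mono_param hσ))
  intro ω hω
  have hω : 8 * (s : ℝ) < sampleCov (designMatrix x ω) j j := hω
  change n * (8 * (s : ℝ)) ≤ ∑ i, ((Pi.single j 1 : Fin p → ℝ) ⬝ᵥ x i ω) ^ 2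
  have h1 := quad_designMatrix x (Pi.single j 1) ω
  rw [single_dotProduct, Matrix.mulVec_single_one, one_mul] at h1
  rw [← le_inv_mul_iff₀ hn0, ← h1]
  exact hω.le

/-- With high probability the sample covariance has bounded diagonal and satisfies restricted
strong convexity. -/
lemma measureReal_not_rsc_le [IsProbabilityMeasure P] (h : IsSubGaussianDesign P x ε Sig σx σε) {s : ℝ≥0} (hs : s ≠ 0)
    (hσ : σx ^ 2 ≤ s) (hn : 0 < n) {κ a : ℝ} (hκ : κ ≤ lambdaMin Sig) (ha0 : 0 ≤ a) (ha : a ≤ κ)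
    {m : ℕ} (hm : 2 ≤ m) :
    P.real {ω | ¬ ((∀ j, sampleCov (designMatrix x ω) j j ≤ 8 * (s : ℝ)) ∧
      ∀ v : Fin p → ℝ, a * (v ⬝ᵥ v) - 8 * (s : ℝ) / (m - 1) * (∑ j, |v j|) ^ 2 ≤
        v ⬝ᵥ (sampleCov (designMatrix x ω) *ᵥ v))} ≤
      (2 * p) ^ m * Real.exp (-((κ - a) ^ 2 / (128 * (s : ℝ) ^ 2) * n)) + p * Real.exp (-n) := by
  set B1 : (Fin m → Fin p × Bool) → Set Ω := fun f =>
    {ω | (∑ i, signedBasis (f i)) ⬝ᵥ (sampleCov (designMatrix x ω) *ᵥ ∑ i, signedBasis (f i)) <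
      a * ((∑ i, signedBasis (f i)) ⬝ᵥ ∑ i, signedBasis (f i))} with hB1
  set B2 : Fin p → Set Ω := fun j => {ω | 8 * (s : ℝ) < sampleCov (designMatrix x ω) j j} with hB2
  have hsub : {ω | ¬ ((∀ j, sampleCov (designMatrix x ω) j j ≤ 8 * (s : ℝ)) ∧
      ∀ v : Fin p → ℝ, a * (v ⬝ᵥ v) - 8 * (s : ℝ) / (m - 1) * (∑ j, |v j|) ^ 2 ≤
        v ⬝ᵥ (sampleCov (designMatrix x ω) *ᵥ v))} ⊆ (⋃ f, B1 f) ∪ ⋃ j, B2 j := by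
    intro ω hω
    by_contra hcon
    simp only [Set.mem_union, Set.mem_iUnion, hB1, hB2, not_or, not_exists, Set.mem_ofPred_eq,
      not_lt] at hcon
    refine hω ⟨hcon.2, fun v => ?_⟩
    set D := sampleCov (designMatrix x ω) - a • (1 : Matrix (Fin p) (Fin p) ℝ) with hD
    have hq : ∀ v : Fin p → ℝ, v ⬝ᵥ (D *ᵥ v) =
        v ⬝ᵥ (sampleCov (designMatrix x ω) *ᵥ v) - a * (v ⬝ᵥ v) := fun v => by
      rw [hD, Matrix.sub_mulVec, dotProduct_sub, Matrix.smul_mulVec, Matrix.one_mulVec,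
        dotProduct_smul, smul_eq_mul]
    have := quad_ge_of_sums_signedBasis D (C := 8 * (s : ℝ)) (fun j => by
      have := hcon.2 j
      simp only [hD, Matrix.sub_apply, Matrix.smul_apply, Matrix.one_apply_eq, smul_eq_mul]
      linarith) hm (fun f => by rw [hq]; linarith [hcon.1 f]) v
    rw [hq] at this
    linarith
  have hB1le : ∀ f, P.real (B1 f) ≤ Real.exp (-((κ - a) ^ 2 / (128 * (s : ℝ) ^ 2) * n)) := by
    intro f
    -- Signed basis vectors may cancel; a zero sum cannot be normalized, but the strict inequality
    -- defining its event then reads `0 < 0`.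
    by_cases h0 : ∑ i, signedBasis (f i) = 0
    · have : B1 f = ∅ := by
        simp only [hB1, h0]
        ext ω; simp
      rw [this]; simp; positivity
    · exact h.measureReal_quad_le hs hσ hn hκ ha h0
  have h1 : P.real (⋃ f, B1 f) ≤
      (2 * p) ^ m * Real.exp (-((κ - a) ^ 2 / (128 * (s : ℝ) ^ 2) * n)) := by
    refine (measureReal_iUnion_fintype_le B1).trans ((Finset.sum_le_sum fun f _ => hB1le f).trans
      (le_of_eq ?_))
    simp [mul_comm]
  have h2 : P.real (⋃ j, B2 j) ≤ p * Real.exp (-n) := by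
    refine (measureReal_iUnion_fintype_le B2).trans ((Finset.sum_le_sum fun j _ =>
      h.measureReal_diag_ge hs hσ hn j).trans (le_of_eq ?_))
    simp
  exact (measureReal_mono hsub).trans ((measureReal_union_le _ _).trans (add_le_add h1 h2))

end IsSubGaussianDesign

end Design

/-! ### Noise projected on directions which depend on the design -/

section Noise

lemma measureReal_abs_sum_mul_ge_le {n : ℕ} (ν : Fin n → Measure ℝ) [∀ i, IsProbabilityMeasure (ν i)]
    {c : ℝ≥0} (hν : ∀ i, HasSubgaussianMGF id c (ν i)) (w : Fin n → ℝ) {B t : ℝ}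
    (hw : ∑ i, w i ^ 2 ≤ B) (ht : 0 ≤ t) :
    (Measure.pi ν).real {e | t ≤ |∑ i, w i * e i|} ≤ 2 * Real.exp (-t ^ 2 / (2 * (c * B))) := by
  have hB : 0 ≤ B := (Finset.sum_nonneg fun i _ => sq_nonneg _).trans hw
  have hsub : ∀ i, HasSubgaussianMGF (fun e : Fin n → ℝ => w i * e i)
      ((w i ^ 2).toNNReal * c) (Measure.pi ν) := by
    intro i
    have h1 : HasSubgaussianMGF (fun e : Fin n → ℝ => e i) c (Measure.pi ν) := by
      rw [← HasSubgaussianMGF.id_map_iff (measurable_pi_apply i).aemeasurable,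
        (measurePreserving_eval ν i).map_eq]
      exact hν i
    refine (h1.const_mul (w i)).mono_param (le_of_eq ?_)
    rw [Real.toNNReal_of_nonneg (sq_nonneg (w i))]
    rfl
  have hind : iIndepFun (fun i (e : Fin n → ℝ) => w i * e i) (Measure.pi ν) :=
    iIndepFun_pi (X := fun i z => w i * z) fun i => by fun_prop
  have hsum := (HasSubgaussianMGF.sum_of_iIndepFun hind (s := Finset.univ)
    fun i _ => hsub i).mono_param (d := c * B.toNNReal) (by
      rw [← Finset.sum_mul, mul_comm]
      refine mul_le_mul_right ?_ _
      rw [← NNReal.coe_le_coe, NNReal.coe_sum, Real.coe_toNNReal B hB]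
      simp only [Real.coe_toNNReal _ (sq_nonneg _)]
      exact hw)
  have hc : ((c * B.toNNReal : ℝ≥0) : ℝ) = c * B := by
    rw [NNReal.coe_mul, Real.coe_toNNReal B hB]
  have h1 := hsum.measure_ge_le ht
  have h2 := hsum.neg.measure_ge_le ht
  rw [hc] at h1 h2
  have hss : {e : Fin n → ℝ | t ≤ |∑ i, w i * e i|} ⊆
      {e | t ≤ ∑ i, w i * e i} ∪ {e | t ≤ (-fun e : Fin n → ℝ => ∑ i, w i * e i) e} := by
    intro e he
    rcases le_abs.1 (show t ≤ |∑ i, w i * e i| from he) with h | h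
    · exact Or.inl h
    · exact Or.inr h
  refine (measureReal_mono hss).trans ((measureReal_union_le _ _).trans ?_)
  linarith

variable {Ω : Type*} [MeasurableSpace Ω] {P : Measure Ω} {n p : ℕ}
  {x : Fin n → Ω → Fin p → ℝ} {ε : Fin n → Ω → ℝ} {Sig : Matrix (Fin p) (Fin p) ℝ} {σx σε : ℝ≥0}

namespace IsSubGaussianDesign

/-- Independence across observations and within each pair makes the joint law of design and noise a
product, so conditioning on the design becomes Fubini's theorem. -/
lemma map_design_noise [IsProbabilityMeasure P] (h : IsSubGaussianDesign P x ε Sig σx σε) :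
    P.map (fun ω => ((fun i => x i ω), fun i => ε i ω)) =
      (Measure.pi fun i => P.map (x i)).prod (Measure.pi fun i => P.map (ε i)) := by
  have hx := h.measurable_x
  have he := h.measurable_noise
  have : ∀ i, IsProbabilityMeasure (P.map (x i)) := fun i =>
    Measure.isProbabilityMeasure_map (hx i).aemeasurable
  have : ∀ i, IsProbabilityMeasure (P.map (ε i)) := fun i =>
    Measure.isProbabilityMeasure_map (he i).aemeasurable
  have h1 := (iIndepFun_iff_map_fun_eq_pi_map fun i => by fun_prop).1 h.indep
  have h2 : ∀ i, P.map (fun ω => (x i ω, ε i ω)) = (P.map (x i)).prod (P.map (ε i)) := fun i =>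
    (indepFun_iff_map_prod_eq_prod_map_map (hx i).aemeasurable (he i).aemeasurable).1
      (h.indep_noise i)
  simp_rw [h2] at h1
  rw [← (measurePreserving_arrowProdEquivProdArrow (Fin p → ℝ) ℝ (Fin n) (fun i => P.map (x i))
    (fun i => P.map (ε i))).map_eq, ← h1, Measure.map_map (MeasurableEquiv.measurable _)
    (by fun_prop)]
  rfl

/-- The size condition on the weights is part of the event: slices at designs violating it are
empty, and the others obey the tail bound for fixed weights. -/
lemma measureReal_noise_ge_le [IsProbabilityMeasure P] (h : IsSubGaussianDesign P x ε Sig σx σε)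
    {c : ℝ≥0} (hc : σε ^ 2 ≤ c) {w : (Fin n → Fin p → ℝ) → Fin n → ℝ} (hw : Measurable w)
    {B t : ℝ} (ht : 0 ≤ t) :
    P.real {ω | ∑ i, w (fun i => x i ω) i ^ 2 ≤ B ∧ t ≤ |∑ i, w (fun i => x i ω) i * ε i ω|} ≤
      2 * Real.exp (-t ^ 2 / (2 * (c * B))) := by
  have hx := h.measurable_x
  have he := h.measurable_noise
  have : ∀ i, IsProbabilityMeasure (P.map (x i)) := fun i =>
    Measure.isProbabilityMeasure_map (hx i).aemeasurable
  have : ∀ i, IsProbabilityMeasure (P.map (ε i)) := fun i =>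
    Measure.isProbabilityMeasure_map (he i).aemeasurable
  set A : Set ((Fin n → Fin p → ℝ) × (Fin n → ℝ)) :=
    {z | ∑ i, w z.1 i ^ 2 ≤ B ∧ t ≤ |∑ i, w z.1 i * z.2 i|} with hA
  have hA1 : MeasurableSet {z : (Fin n → Fin p → ℝ) × (Fin n → ℝ) | ∑ i, w z.1 i ^ 2 ≤ B} :=
    measurableSet_le (by fun_prop) measurable_const
  have hA2 : MeasurableSet
      {z : (Fin n → Fin p → ℝ) × (Fin n → ℝ) | t ≤ |∑ i, w z.1 i * z.2 i|} :=
    measurableSet_le measurable_const (by fun_prop)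
  have hAm : MeasurableSet A := hA1.inter hA2
  have hpre : {ω | ∑ i, w (fun i => x i ω) i ^ 2 ≤ B ∧ t ≤ |∑ i, w (fun i => x i ω) i * ε i ω|} =
      (fun ω => ((fun i => x i ω), fun i => ε i ω)) ⁻¹' A := rfl
  rw [hpre, measureReal_def, ← Measure.map_apply (by fun_prop) hAm, h.map_design_noise,
    Measure.prod_apply hAm]
  refine ENNReal.toReal_le_of_le_ofReal (by positivity) ?_
  refine (lintegral_mono (g := fun _ => ENNReal.ofReal (2 * Real.exp (-t ^ 2 / (2 * (c * B)))))
    fun ξ => ?_).trans (by simp)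
  by_cases hξ : ∑ i, w ξ i ^ 2 ≤ B
  · have h1 := measureReal_abs_sum_mul_ge_le (fun i => P.map (ε i)) (c := c) (fun i => by
      rw [HasSubgaussianMGF.id_map_iff (he i).aemeasurable]
      exact (h.subGaussian_noise i).mono_param hc) (w ξ) hξ ht
    have e : Prod.mk ξ ⁻¹' A = {e | t ≤ |∑ i, w ξ i * e i|} := by
      ext e
      simp [hA, hξ]
    rw [e, ← ofReal_measureReal]
    exact ENNReal.ofReal_le_ofReal h1
  · have e : Prod.mk ξ ⁻¹' A = ∅ := by
      ext e
      simp [hA, hξ]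
    rw [e]; simp

/-- Conditionally on the design, a linear functional of `Xᵀε / n` whose coefficients are determined
by the design is sub-Gaussian. -/
lemma measureReal_cross_ge_le [IsProbabilityMeasure P] (h : IsSubGaussianDesign P x ε Sig σx σε)
    {c : ℝ≥0} (hc : σε ^ 2 ≤ c) (hn : 0 < n) {a : (Fin n → Fin p → ℝ) → Fin p → ℝ}
    (ha : Measurable a) {B t : ℝ} (ht : 0 ≤ t) :
    P.real {ω | a (fun i => x i ω) ⬝ᵥ (sampleCov (designMatrix x ω) *ᵥ a (fun i => x i ω)) ≤ B ∧
      t ≤ |a (fun i => x i ω) ⬝ᵥ sampleCross (designMatrix x ω) (fun i => ε i ω)|} ≤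
      2 * Real.exp (-(t ^ 2 * n) / (2 * (c * B))) := by
  have hn0 : (0 : ℝ) < n := by exact_mod_cast hn
  have h1 := h.measureReal_noise_ge_le hc (w := fun ξ i => (n : ℝ)⁻¹ * (a ξ ⬝ᵥ ξ i)) (B := B / n)
    (by simp only [dotProduct]; fun_prop) ht
  have e1 : -t ^ 2 / (2 * (c * (B / n))) = -(t ^ 2 * n) / (2 * (c * B)) := by
    rw [← mul_div_assoc, ← mul_div_assoc, div_div_eq_mul_div, neg_mul]
  rw [e1] at h1
  refine le_trans (measureReal_mono ?_) h1
  rintro ω ⟨hω1, hω2⟩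
  refine ⟨?_, ?_⟩
  · rw [quad_designMatrix] at hω1
    simp only [mul_pow]
    rw [← Finset.mul_sum, le_div_iff₀ hn0, sq, mul_assoc, mul_assoc, mul_comm _ (n : ℝ),
      ← mul_assoc (n : ℝ)⁻¹ n, inv_mul_cancel₀ hn0.ne', one_mul]
    exact hω1
  · refine hω2.trans (le_of_eq ?_)
    congr 1
    rw [sampleCross, dotProduct_smul, smul_eq_mul, Matrix.dotProduct_mulVec,
      Matrix.vecMul_transpose, dotProduct, Finset.mul_sum]
    refine Finset.sum_congr rfl fun i _ => ?_
    rw [mul_assoc, dotProduct_comm (a _)]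
    rfl

end IsSubGaussianDesign

section Measurability

variable (S : Finset (Fin p))

lemma continuous_sampleCov_of :
    Continuous fun ξ : Fin n → Fin p → ℝ => sampleCov (Matrix.of ξ) := by
  unfold sampleCov
  have : Continuous fun ξ : Fin n → Fin p → ℝ => Matrix.of ξ := continuous_id
  fun_prop

/-- Inversion is discontinuous at singular matrices, but the adjugate formula with `0⁻¹ = 0` is
measurable everywhere. -/
lemma measurable_inv_apply {m : Type*} [Fintype m] [DecidableEq m] {E : Type*} [TopologicalSpace E]
    [MeasurableSpace E] [BorelSpace E] {A : E → Matrix m m ℝ} (hA : Continuous A) (i j : m) :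
    Measurable fun ξ => (A ξ)⁻¹ i j := by
  have e : (fun ξ => (A ξ)⁻¹ i j) = fun ξ => ((A ξ).det)⁻¹ * (A ξ).adjugate i j := by
    ext ξ
    rw [Matrix.inv_def, Matrix.smul_apply, Ring.inverse_eq_inv', smul_eq_mul]
  rw [e]
  exact hA.matrix_det.measurable.inv.mul (hA.matrix_adjugate.matrix_elem i j).measurable

lemma measurable_noiseDirS (j : Fin p) :
    Measurable fun ξ : Fin n → Fin p → ℝ => noiseDirS (sampleCov (Matrix.of ξ)) S j := by
  refine measurable_pi_iff.2 fun i => ?_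
  unfold noiseDirS extendZero
  by_cases hj : j ∈ S
  · by_cases hi : i ∈ S
    · simp only [hj, hi, dif_pos]
      exact measurable_inv_apply (continuous_sampleCov_of.matrix_submatrix _ _) _ _
    · simp only [hj, hi, dif_pos, dif_neg, not_false_eq_true, measurable_const]
  · simp only [hj, dif_neg, not_false_eq_true, Pi.zero_apply, measurable_const]

lemma measurable_noiseDirSc (j : Fin p) :
    Measurable fun ξ : Fin n → Fin p → ℝ => noiseDirSc (sampleCov (Matrix.of ξ)) S j := by
  refine measurable_pi_iff.2 fun i => ?_
  unfold noiseDirSc extendZero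
  by_cases hj : j ∈ S
  · simp only [hj, not_true_eq_false, dif_neg, not_false_eq_true, Pi.zero_apply, measurable_const]
  · by_cases hi : i ∈ S
    · simp only [hj, hi, dif_pos, not_false_eq_true, Pi.sub_apply]
      refine measurable_const.sub ?_
      simp only [Matrix.mul_apply]
      refine Finset.measurable_fun_sum _ fun l _ => ?_
      exact (continuous_sampleCov_of.matrix_elem _ _).measurable.mul
        (measurable_inv_apply (continuous_sampleCov_of.matrix_submatrix _ _) _ _)
    · simp only [hj, hi, dif_pos, dif_neg, not_false_eq_true, Pi.sub_apply, measurable_const]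

end Measurability

end Noise

/-! ### The good event -/

section GoodEvent

/-- Restricted strong convexity, together with bounds on the noise and on its projections. -/
structure IsGoodSample {n p : ℕ} (X : Matrix (Fin n) (Fin p) ℝ) (ε : Fin n → ℝ)
    (S : Finset (Fin p)) (κ' T t₁ t₂ : ℝ) : Prop where
  rsc : ∀ v : Fin p → ℝ,
    κ' * (v ⬝ᵥ v) - T * (∑ j, |v j|) ^ 2 ≤ v ⬝ᵥ (sampleCov X *ᵥ v)
  noise : ∀ j, |sampleCross X ε j| ≤ t₂
  noiseS : IsUnit (blockSS (sampleCov X) S) →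
    ∀ j, |noiseDirS (sampleCov X) S j ⬝ᵥ sampleCross X ε| ≤ t₁
  noiseSc : IsUnit (blockSS (sampleCov X) S) →
    ∀ j, |noiseDirSc (sampleCov X) S j ⬝ᵥ sampleCross X ε| ≤ t₂

variable {Ω : Type*} [MeasurableSpace Ω] {P : Measure Ω} {n p : ℕ}
  {x : Fin n → Ω → Fin p → ℝ} {ε : Fin n → Ω → ℝ} {Sig : Matrix (Fin p) (Fin p) ℝ} {σx σε : ℝ≥0}

namespace IsSubGaussianDesign

lemma measureReal_exists_cross_gt_le [IsProbabilityMeasure P]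
    (h : IsSubGaussianDesign P x ε Sig σx σε) {c : ℝ≥0} (hc0 : c ≠ 0) (hc : σε ^ 2 ≤ c)
    (hn : 0 < n) (hp : 0 < p) {a : Fin p → (Fin n → Fin p → ℝ) → Fin p → ℝ}
    (ha : ∀ j, Measurable (a j)) {B : ℝ} (hB : 0 < B) :
    P.real {ω | ∃ j, a j (fun i => x i ω) ⬝ᵥ
        (sampleCov (designMatrix x ω) *ᵥ a j (fun i => x i ω)) ≤ B ∧
      √(4 * c * B) * √(Real.log p / n) <
        |a j (fun i => x i ω) ⬝ᵥ sampleCross (designMatrix x ω) (fun i => ε i ω)|} ≤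
      2 * (p : ℝ)⁻¹ := by
  have hc1 : (0 : ℝ) < c := by exact_mod_cast pos_iff_ne_zero.2 hc0
  have hn0 : (0 : ℝ) < n := by exact_mod_cast hn
  have hp0 : (0 : ℝ) < p := by exact_mod_cast hp
  have hlog : 0 ≤ Real.log p := Real.log_natCast_nonneg p
  set t := √(4 * c * B) * √(Real.log p / n) with ht
  have ht0 : 0 ≤ t := by positivity
  have ht2 : t ^ 2 = 4 * c * B * (Real.log p / n) := by
    rw [ht, mul_pow, Real.sq_sqrt (by positivity), Real.sq_sqrt (by positivity)]
  -- The factor `4` in the threshold gives the exponent `-2 log p`: one factor `1/p` pays for the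
  -- union over coordinates, the other remains.
  have hexp : Real.exp (-(t ^ 2 * n) / (2 * (c * B))) = (p : ℝ)⁻¹ * (p : ℝ)⁻¹ := by
    have e : -(t ^ 2 * n) / (2 * (c * B)) = -Real.log p + -Real.log p := by
      rw [ht2]; field_simp; ring
    rw [e, Real.exp_add, Real.exp_neg, Real.exp_log hp0]
  have hle := fun j => h.measureReal_cross_ge_le hc hn (ha j) (B := B) ht0
  rw [hexp] at hle
  refine (measureReal_mono (s₂ := ⋃ j, {ω | a j (fun i => x i ω) ⬝ᵥ
        (sampleCov (designMatrix x ω) *ᵥ a j (fun i => x i ω)) ≤ B ∧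
      t ≤ |a j (fun i => x i ω) ⬝ᵥ sampleCross (designMatrix x ω) (fun i => ε i ω)|}) ?_).trans
    ((measureReal_iUnion_fintype_le _).trans ((Finset.sum_le_sum fun j _ => hle j).trans
      (le_of_eq ?_)))
  · rintro ω ⟨j, h1, h2⟩
    exact Set.mem_iUnion.2 ⟨j, h1, h2.le⟩
  · rw [Finset.sum_const, Finset.card_univ, Fintype.card_fin, nsmul_eq_mul]
    field_simp

/-- Restricted strong convexity with a tolerance of order `log p / n`. -/
lemma measureReal_not_rsc_le_inv [IsProbabilityMeasure P] (h : IsSubGaussianDesign P x ε Sig σx σε)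
    {s : ℝ≥0} (hs : s ≠ 0) (hσ : σx ^ 2 ≤ s) (hp : 2 ≤ p) {κ a r : ℝ}
    (hκ : κ ≤ lambdaMin Sig) (ha0 : 0 ≤ a) (ha : a < κ)
    (hr : r = (κ - a) ^ 2 / (128 * (s : ℝ) ^ 2))
    (hn1 : 8 / r * Real.log p ≤ n) (hn2 : 2 * Real.log p ≤ n) :
    P.real {ω | ¬ ((∀ j, sampleCov (designMatrix x ω) j j ≤ 8 * (s : ℝ)) ∧
      ∀ v : Fin p → ℝ, a * (v ⬝ᵥ v) - 256 * s / r * (Real.log p / n) * (∑ j, |v j|) ^ 2 ≤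
        v ⬝ᵥ (sampleCov (designMatrix x ω) *ᵥ v))} ≤ 2 * (p : ℝ)⁻¹ := by
  have hs0 : (0 : ℝ) < s := by exact_mod_cast pos_iff_ne_zero.2 hs
  have hp2 : (2 : ℝ) ≤ p := by exact_mod_cast hp
  have hlog : 0 < Real.log p := Real.log_pos (by linarith)
  have hr0 : 0 < r := by
    rw [hr]
    have : 0 < κ - a := by linarith
    positivity
  have hn0 : (0 : ℝ) < n := by linarith
  have hn : 0 < n := by exact_mod_cast hn0
  -- With at most this many summands `(2p)^m ≤ exp (2 m log p) ≤ exp (r n / 2)`, so the union bound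
  -- spends half of the exponent.
  set y : ℝ := r * n / (4 * Real.log p) with hy
  have hy2 : 2 ≤ y := by
    rw [div_mul_eq_mul_div, div_le_iff₀ hr0] at hn1
    rw [hy, le_div_iff₀ (by positivity)]
    linarith
  set m := ⌊y⌋₊ with hm
  have hm2 : 2 ≤ m := Nat.le_floor (by exact_mod_cast hy2)
  have hmy : (m : ℝ) ≤ y := Nat.floor_le (by linarith)
  have hmy2 : y < m + 1 := Nat.lt_floor_add_one y
  have hm2' : (2 : ℝ) ≤ m := by exact_mod_cast hm2
  -- From `m ≥ 2` and `y < m + 1` follows `m - 1 ≥ y / 8`; the constant is `256 = 8 * 8 * 4`.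
  have htol : 8 * (s : ℝ) / (m - 1) ≤ 256 * s / r * (Real.log p / n) := by
    have e : 256 * s / r * (Real.log p / n) = 8 * s / (y / 8) := by
      rw [hy]; field_simp; ring
    rw [e]
    exact div_le_div_of_nonneg_left (by positivity) (by positivity) (by linarith)
  have hbound := h.measureReal_not_rsc_le hs hσ hn hκ ha0 ha.le hm2
  rw [← hr] at hbound
  have h1 : (2 * (p : ℝ)) ^ m * Real.exp (-(r * n)) ≤ (p : ℝ)⁻¹ := by
    have e1 : (2 * (p : ℝ)) ^ m ≤ Real.exp (m * (2 * Real.log p)) := by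
      rw [Real.exp_nat_mul]
      refine pow_le_pow_left₀ (by positivity) ?_ m
      rw [two_mul (Real.log p), Real.exp_add, Real.exp_log (by linarith)]
      exact mul_le_mul_of_nonneg_right hp2 (by linarith)
    have e2 : m * (2 * Real.log p) ≤ r * n / 2 := by
      have := mul_le_mul_of_nonneg_right hmy (by positivity : 0 ≤ 2 * Real.log p)
      have e3 : y * (2 * Real.log p) = r * n / 2 := by rw [hy]; field_simp; ring
      linarith
    have e4 : Real.log p ≤ r * n / 2 := by
      rw [div_mul_eq_mul_div, div_le_iff₀ hr0] at hn1
      linarith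
    calc (2 * (p : ℝ)) ^ m * Real.exp (-(r * n))
        ≤ Real.exp (m * (2 * Real.log p)) * Real.exp (-(r * n)) :=
          mul_le_mul_of_nonneg_right e1 (Real.exp_pos _).le
      _ = Real.exp (m * (2 * Real.log p) + -(r * n)) := (Real.exp_add _ _).symm
      _ ≤ Real.exp (-Real.log p) := Real.exp_le_exp.2 (by linarith)
      _ = (p : ℝ)⁻¹ := by rw [Real.exp_neg, Real.exp_log (by linarith)]
  have h2 : p * Real.exp (-n) ≤ (p : ℝ)⁻¹ := by
    calc p * Real.exp (-n) = Real.exp (Real.log p + -n) := by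
          rw [Real.exp_add, Real.exp_log (by linarith)]
      _ ≤ Real.exp (-Real.log p) := Real.exp_le_exp.2 (by linarith)
      _ = (p : ℝ)⁻¹ := by rw [Real.exp_neg, Real.exp_log (by linarith)]
  refine (measureReal_mono ?_).trans (hbound.trans (by linarith))
  intro ω hω hcon
  refine hω ⟨hcon.1, fun v => le_trans ?_ (hcon.2 v)⟩
  have := mul_le_mul_of_nonneg_right htol (sq_nonneg (∑ j, |v j|))
  linarith

/-- Four bad events of probability at most `2/p` each: failure of curvature or of the diagonal
bound, and large noise along the basis vectors, along `noiseDirS` and along `noiseDirSc`. Off the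
first event, the diagonal bound and curvature on `S` control the quadratic forms of these
directions. -/
lemma measureReal_not_good_le [IsProbabilityMeasure P] (h : IsSubGaussianDesign P x ε Sig σx σε)
    {s c : ℝ≥0} (hs : s ≠ 0) (hσ : σx ^ 2 ≤ s) (hc0 : c ≠ 0) (hc : σε ^ 2 ≤ c)
    (hp : 2 ≤ p) {κ a r α : ℝ} {k : ℕ} {S : Finset (Fin p)} (hk : S.card ≤ k)
    (hκ : κ ≤ lambdaMin Sig) (ha0 : 0 ≤ a) (ha : a < κ)
    (hr : r = (κ - a) ^ 2 / (128 * (s : ℝ) ^ 2))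
    (hn1 : 8 / r * Real.log p ≤ n) (hn2 : 2 * Real.log p ≤ n) (hα0 : 0 < α)
    (hα : α ≤ a - 256 * s / r * (Real.log p / n) * k) :
    P.real {ω | ¬ IsGoodSample (designMatrix x ω) (fun i => ε i ω) S a
      (256 * s / r * (Real.log p / n)) (√(4 * c * (1 / α)) * √(Real.log p / n))
      (√(4 * c * (8 * s)) * √(Real.log p / n))} ≤ 8 * (p : ℝ)⁻¹ := by
  have hs0 : (0 : ℝ) < s := by exact_mod_cast pos_iff_ne_zero.2 hs
  have hp2 : (2 : ℝ) ≤ p := by exact_mod_cast hp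
  have hlog : 0 < Real.log p := Real.log_pos (by linarith)
  have hn0 : (0 : ℝ) < n := by linarith
  have hn : 0 < n := by exact_mod_cast hn0
  have hr0 : 0 < r := by
    rw [hr]
    have : 0 < κ - a := by linarith
    positivity
  have hT : 0 ≤ 256 * s / r * (Real.log p / n) := by positivity
  have hR := h.measureReal_not_rsc_le_inv hs hσ hp hκ ha0 ha hr hn1 hn2
  have hN := h.measureReal_exists_cross_gt_le hc0 hc hn (by omega)
    (a := fun j _ => Pi.single j 1) (fun j => measurable_const) (B := 8 * s) (by positivity)
  have hNS := h.measureReal_exists_cross_gt_le hc0 hc hn (by omega)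
    (fun j => measurable_noiseDirS S j) (B := 1 / α) (by positivity)
  have hNSc := h.measureReal_exists_cross_gt_le hc0 hc hn (by omega)
    (fun j => measurable_noiseDirSc S j) (B := 8 * s) (by positivity)
  refine (measureReal_mono ?_).trans (((measureReal_union_le _ _).trans (add_le_add
    ((measureReal_union_le _ _).trans (add_le_add hR hN))
    ((measureReal_union_le _ _).trans (add_le_add hNS hNSc)))).trans (by linarith))
  intro ω hω
  by_contra hcon
  rw [Set.mem_union, Set.mem_union, Set.mem_union, not_or, not_or, not_or] at hcon
  obtain ⟨⟨h1, h2⟩, h3, h4⟩ := hcon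
  obtain ⟨hdiag, hrsc⟩ := not_not.1 h1
  refine hω ⟨hrsc, fun j => ?_, fun hU j => ?_, fun hU j => ?_⟩
  · by_contra hj
    refine h2 ⟨j, ?_, ?_⟩
    · rw [single_dotProduct, Matrix.mulVec_single_one, one_mul]
      exact hdiag j
    · rw [single_dotProduct, one_mul]
      exact not_le.1 hj
  · by_contra hj
    refine h3 ⟨j, ?_, not_le.1 hj⟩
    refine quad_noiseDirS_le (designMatrix x ω) hU hα0 (fun v hv => ?_) j
    have h5 := curvature_of_supported (τ := 256 * s / r) (L := Real.log p / n) hT hk hrsc hv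
    have h0 : 0 ≤ v ⬝ᵥ v := Finset.sum_nonneg fun i _ => mul_self_nonneg _
    exact (mul_le_mul_of_nonneg_right hα h0).trans h5
  · by_contra hj
    exact h4 ⟨j, (quad_noiseDirSc_le (designMatrix x ω) hU j).trans (hdiag j), not_le.1 hj⟩

end IsSubGaussianDesign

end GoodEvent

/-! ### Choice of constants and conclusion -/

lemma measure_le_of_imp_not_good {Ω : Type*} [MeasurableSpace Ω] {P : Measure Ω}
    [IsProbabilityMeasure P] {A : Set Ω} {good : Ω → Prop} {k p : ℕ} (hp : 0 < p)
    (hA : ∀ ω, good ω → ω ∉ A) (hgood : P.real {ω | ¬ good ω} ≤ 8 * (p : ℝ)⁻¹) :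
    P A ≤ ENNReal.ofReal (8 * Real.exp (-1 * min (k : ℝ) (Real.log p))) := by
  have hp0 : (0 : ℝ) < p := by exact_mod_cast hp
  have h1 : P.real A ≤ 8 * (p : ℝ)⁻¹ :=
    (measureReal_mono fun ω hω hg => hA ω hg hω).trans hgood
  rw [← ofReal_measureReal]
  refine ENNReal.ofReal_le_ofReal (h1.trans ?_)
  refine mul_le_mul_of_nonneg_left ?_ (by norm_num)
  rw [← Real.exp_log hp0, ← Real.exp_neg, Real.log_exp]
  exact Real.exp_le_exp.2 (by linarith [min_le_right (k : ℝ) (Real.log p)])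

theorem mainTheorem3 (σx σε : ℝ≥0) (κ μ η : ℝ) (hμ : 0 ≤ μ) (hμκ : μ < κ) (hη : η < 1) :
    ∃ c0 cl cu c1 c2 c3 : ℝ, 0 < c0 ∧ 0 < cl ∧ 0 < cu ∧ 0 < c1 ∧ 0 < c2 ∧ 0 < c3 ∧
      ∀ (Ω : Type*) [MeasurableSpace Ω] (P : Measure Ω) [IsProbabilityMeasure P]
        (n p k : ℕ) (x : Fin n → Ω → Fin p → ℝ) (ε : Fin n → Ω → ℝ)
        (Sig : Matrix (Fin p) (Fin p) ℝ) (βs : Fin p → ℝ) (lam R cinf : ℝ) (rho : ℝ → ℝ),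
        IsSubGaussianDesign P x ε Sig σx σε →
        κ ≤ lambdaMin Sig →
        (supp βs).card ≤ k →
        c0 * k * Real.log p ≤ n →
        0 < R →
        ∑ j, |βs j| ≤ R / 2 →
        cl * √(Real.log p / n) ≤ lam →
        lam ≤ cu / R →
        -- part (a)
        (IsAmenable μ lam rho →
          P {ω | InvBound (sampleCov (designMatrix x ω)) (supp βs) cinf ∧
                opNormInf (blockScS (sampleCov (designMatrix x ω)) (supp βs) *
                  (blockSS (sampleCov (designMatrix x ω)) (supp βs))⁻¹) ≤ η ∧
                ¬ ∃ βh : Fin p → ℝ,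
                  (∀ b, IsStationaryPoint (designMatrix x ω) (response x ε βs ω) rho R b ↔
                    b = βh) ∧
                  IsMinOn (lsObjective (designMatrix x ω) (response x ε βs ω) rho)
                    (l1Ball p R) βh ∧
                  supp βh ⊆ supp βs ∧
                  ∀ j, |βh j - βs j| ≤ c3 * √(Real.log p / n) + cinf * lam} ≤
            ENNReal.ofReal (c1 * Real.exp (-c2 * min (k : ℝ) (Real.log p)))) ∧
        -- part (b)
        (∀ γ : ℝ, IsUnbiasedAmenable μ γ lam rho →
          (∀ j ∈ supp βs, lam * (γ + cinf) + c3 * √(Real.log p / n) ≤ |βs j|) →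
          P {ω | InvBound (sampleCov (designMatrix x ω)) (supp βs) cinf ∧
                ¬ ∃ βh : Fin p → ℝ,
                  (∀ b, IsStationaryPoint (designMatrix x ω) (response x ε βs ω) rho R b ↔
                    b = βh) ∧
                  (∀ b, IsOracle (designMatrix x ω) (response x ε βs ω) (supp βs) b ↔
                    b = βh) ∧
                  ∀ j, |βh j - βs j| ≤ c3 * √(Real.log p / n)} ≤
            ENNReal.ofReal (c1 * Real.exp (-c2 * min (k : ℝ) (Real.log p)))) := by
  -- The variance proxies are enlarged by `1` so that they can be divided by even when a parameter
  -- vanishes.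
  set s : ℝ≥0 := σx ^ 2 + 1 with hs
  set c : ℝ≥0 := σε ^ 2 + 1 with hc
  have hs0 : s ≠ 0 := (add_pos_of_nonneg_of_pos zero_le one_pos).ne'
  have hc0 : c ≠ 0 := (add_pos_of_nonneg_of_pos zero_le one_pos).ne'
  have hs1 : (0 : ℝ) < s := by exact_mod_cast pos_iff_ne_zero.2 hs0
  have hc1 : (0 : ℝ) < c := by exact_mod_cast pos_iff_ne_zero.2 hc0
  -- The gap `g` is split: `g / 4` is lost to concentration (`κ - a`), and `τ L k ≤ g / 4` to
  -- sparsity. This leaves `a - τ L k ≥ α > μ` and `a - μ - 2 τ L k ≥ g / 4 > 0`.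
  obtain ⟨g, hg⟩ : ∃ g, g = κ - μ := ⟨_, rfl⟩
  have hg0 : 0 < g := by linarith
  obtain ⟨a, ha⟩ : ∃ a, a = μ + 3 * g / 4 := ⟨_, rfl⟩
  obtain ⟨α, hα⟩ : ∃ α, α = μ + g / 2 := ⟨_, rfl⟩
  have hα0 : 0 < α := by linarith
  obtain ⟨r, hr⟩ : ∃ r, r = (κ - a) ^ 2 / (128 * (s : ℝ) ^ 2) := ⟨_, rfl⟩
  have hr0 : 0 < r := by
    rw [hr]
    have : 0 < κ - a := by linarith
    positivity
  obtain ⟨τ, hτ⟩ : ∃ τ, τ = 256 * s / r := ⟨_, rfl⟩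
  have hτ0 : 0 < τ := by rw [hτ]; positivity
  obtain ⟨δ, hδ⟩ : ∃ δ, δ = min ((1 - η) / 2) (1 / 2) := ⟨_, rfl⟩
  have hδ0 : 0 < δ := by rw [hδ]; exact lt_min (by linarith) (by norm_num)
  have hδ1 : δ ≤ (1 - η) / 2 := by rw [hδ]; exact min_le_left _ _
  have hδ2 : δ ≤ 1 / 2 := by rw [hδ]; exact min_le_right _ _
  obtain ⟨θ, hθ⟩ : ∃ θ, θ = min (1 / 3) ((α - μ) / α) := ⟨_, rfl⟩
  have hθ0 : 0 < θ := by rw [hθ]; exact lt_min (by norm_num) (div_pos (by linarith) hα0)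
  have hθ1 : θ ≤ 1 / 3 := by rw [hθ]; exact min_le_left _ _
  have hθ2 : θ * α ≤ α - μ := by
    rw [← le_div_iff₀ hα0, hθ]; exact min_le_right _ _
  obtain ⟨C₂, hC₂⟩ : ∃ C₂, C₂ = √(4 * c * (8 * s)) := ⟨_, rfl⟩
  have hC₂0 : 0 < C₂ := by rw [hC₂]; positivity
  obtain ⟨c3, hc3⟩ : ∃ c3, c3 = √(4 * c * (1 / α)) := ⟨_, rfl⟩
  have hc30 : 0 < c3 := by rw [hc3]; positivity
  obtain ⟨cl, hcl⟩ : ∃ cl, cl = C₂ / θ + C₂ / δ := ⟨_, rfl⟩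
  have hcl0 : 0 < cl := by rw [hcl]; positivity
  -- Chosen so that `lam ≤ cu / R` and `cl² L ≤ lam²` together give `4 R τ L ≤ δ lam`.
  obtain ⟨cu, hcu⟩ : ∃ cu, cu = δ * cl ^ 2 / (4 * τ) := ⟨_, rfl⟩
  have hcu0 : 0 < cu := by rw [hcu]; positivity
  -- One summand for each sample-size requirement: at least two vectors in the Maurey sums, the
  -- diagonal bound, and `τ L k ≤ g / 4`.
  obtain ⟨c0, hc0'⟩ : ∃ c0, c0 = 8 / r + 2 + 4 * τ / g := ⟨_, rfl⟩
  have hc00 : 0 < c0 := by rw [hc0']; positivity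
  refine ⟨c0, cl, cu, 8, 1, c3, hc00, hcl0, hcu0, by norm_num, by norm_num, hc30, ?_⟩
  intro Ω _ P _ n p k x ε Sig βs lam R cinf rho hdes hκ hk hn hR hβ hlam1 hlam2
  -- For `k = 0` or `p ≤ 1` the claimed probability bound is at least `8`, hence trivial.
  rcases le_or_gt (min (k : ℝ) (Real.log p)) 0 with hmin | hmin
  · have hone : ∀ A : Set Ω, P A ≤ ENNReal.ofReal (8 * Real.exp (-1 * min (k : ℝ) (Real.log p))) := by
      intro A
      refine prob_le_one.trans ?_
      rw [← ENNReal.ofReal_one]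
      refine ENNReal.ofReal_le_ofReal ?_
      have := Real.one_le_exp (x := -1 * min (k : ℝ) (Real.log p)) (by linarith)
      linarith
    exact ⟨fun _ => hone _, fun _ _ _ => hone _⟩
  have hk0 : (0 : ℝ) < k := hmin.trans_le (min_le_left _ _)
  have hlog : 0 < Real.log p := hmin.trans_le (min_le_right _ _)
  have hk1 : (1 : ℝ) ≤ k := by exact_mod_cast hk0
  have hp : 2 ≤ p := by
    by_contra hp
    have : p = 0 ∨ p = 1 := by omega
    rcases this with rfl | rfl <;> simp at hlog
  have hklog : Real.log p ≤ k * Real.log p := le_mul_of_one_le_left hlog.le hk1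
  have hterm : ∀ w, 0 ≤ w → w ≤ c0 → w * (k * Real.log p) ≤ n := fun w _ hw =>
    (mul_le_mul_of_nonneg_right hw (by positivity)).trans (by rw [← mul_assoc]; exact hn)
  have h8r : 0 < 8 / r := by positivity
  have h4τ : 0 < 4 * τ / g := by positivity
  have hn1 : 8 / r * Real.log p ≤ n :=
    (mul_le_mul_of_nonneg_left hklog h8r.le).trans (hterm _ h8r.le (by linarith))
  have hn2 : 2 * Real.log p ≤ n :=
    (mul_le_mul_of_nonneg_left hklog (by norm_num)).trans (hterm _ (by norm_num) (by linarith))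
  have hn3 : 4 * τ / g * (k * Real.log p) ≤ n := hterm _ h4τ.le (by linarith)
  have hn0 : (0 : ℝ) < n := by linarith
  obtain ⟨L, hL⟩ : ∃ L, L = Real.log p / n := ⟨_, rfl⟩
  have hL0 : 0 < L := by rw [hL]; positivity
  rw [← hL] at hlam1
  have hsq0 : 0 < √L := Real.sqrt_pos.2 hL0
  have hlam : 0 < lam := (mul_pos hcl0 hsq0).trans_le hlam1
  have hTk : τ * L * k ≤ g / 4 := by
    rw [div_mul_eq_mul_div, div_le_iff₀ hg0] at hn3
    have e : τ * L * k = τ * (k * Real.log p) / n := by rw [hL]; ring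
    rw [e, div_le_iff₀ hn0]
    linarith
  have hT0 : 0 ≤ τ * L := by positivity
  have hC₂θ : C₂ * √L ≤ θ * lam := by
    have h1 : C₂ / θ * √L ≤ lam := le_trans (mul_le_mul_of_nonneg_right (by
      rw [hcl]; linarith [div_pos hC₂0 hδ0]) hsq0.le) hlam1
    rw [div_mul_eq_mul_div, div_le_iff₀ hθ0] at h1
    linarith
  have hC₂δ : C₂ * √L ≤ δ * lam := by
    have h1 : C₂ / δ * √L ≤ lam := le_trans (mul_le_mul_of_nonneg_right (by
      rw [hcl]; linarith [div_pos hC₂0 hθ0]) hsq0.le) hlam1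
    rw [div_mul_eq_mul_div, div_le_iff₀ hδ0] at h1
    linarith
  have hRT : 4 * R * (τ * L) ≤ δ * lam := by
    have h1 : cl ^ 2 * L ≤ lam ^ 2 := by
      have := pow_le_pow_left₀ (by positivity) hlam1 2
      rwa [mul_pow, Real.sq_sqrt hL0.le] at this
    rw [le_div_iff₀ hR, hcu, le_div_iff₀ (by positivity)] at hlam2
    have h2 : cl ^ 2 * (4 * R * (τ * L)) ≤ cl ^ 2 * (δ * lam) := by
      calc cl ^ 2 * (4 * R * (τ * L)) = 4 * R * τ * (cl ^ 2 * L) := by ring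
        _ ≤ 4 * R * τ * lam ^ 2 := mul_le_mul_of_nonneg_left h1 (by positivity)
        _ = lam * R * (4 * τ) * lam := by ring
        _ ≤ δ * cl ^ 2 * lam := mul_le_mul_of_nonneg_right hlam2 hlam.le
        _ = _ := by ring
    exact le_of_mul_le_mul_left h2 (by positivity)
  have hgood := hdes.measureReal_not_good_le hs0 (le_add_of_nonneg_right zero_le_one) hc0
    (le_add_of_nonneg_right zero_le_one) hp (α := α) (a := a) hk hκ (by linarith) (by linarith) hr
    hn1 hn2 hα0 (by rw [← hτ, ← hL]; linarith)
  rw [← hτ, ← hL, ← hC₂, ← hc3] at hgood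
  have hβS : ∀ j ∉ supp βs, βs j = 0 := fun j hj => by
    by_contra hne
    exact hj (by simp [supp, hne])
  have ht : 0 ≤ c3 * √L := by positivity
  rw [← hL]
  refine ⟨fun ham => ?_, fun γ ham hsig => ?_⟩
  · refine measure_le_of_imp_not_good (by omega) (fun ω hω => ?_) hgood
    rintro ⟨hinv, hinc, hno⟩
    obtain ⟨b, h1, h2, h3, h4⟩ := support_recovery_of_incoherence (designMatrix x ω)
      (fun i => ε i ω) βs ham hlam hT0 hk hω.rsc (by linarith : μ < α) (by linarith)
      (by linarith) hδ0.le hRT hθ0.le hθ1 hθ2 hR hβ hβS (fun j => (hω.noise j).trans hC₂θ)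
      (hω.noiseS hinv.1) (fun j => (hω.noiseSc hinv.1 j).trans hC₂δ) ht hinv hinc (by linarith)
    refine hno ⟨b, h1, h2, fun j hj => ?_, h4⟩
    by_contra hjS
    simp [supp, h3 j hjS] at hj
  · refine measure_le_of_imp_not_good (by omega) (fun ω hω => ?_) hgood
    rintro ⟨hinv, hno⟩
    exact hno (oracle_of_unbiased (designMatrix x ω) (fun i => ε i ω) βs ham hlam hT0 hk hω.rsc
      (by linarith) (by linarith) hδ0.le hRT hδ2 hβ hβS (hω.noiseS hinv.1)
      (fun j => (hω.noiseSc hinv.1 j).trans hC₂δ) ht hinv hsig)
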